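/- All graphs are finite, simple, undirected and have at least one vertex; graphs and families of graphs are considered up to isomorphism. For non-adjacent distinct vertices $a,b$ of a graph $G$, an $a,b$-separator is a set $S\subseteq V(G)\setminus\{a,b\}$ such that $a$ and $b$ lie in different components of $G-S$; a minimal separator of $G$ is an inclusion-minimal $a,b$-separator for some such pair $a,b$. Let $s(G)$ denote the number of minimal separators of $G$. A class $\mathcal{G}$ of graphs is tame if there is a polynomial $p:\mathbb{R}\to\mathbb{R}$ such that $s(G)\le p(|V(G)|)$ for all $G\in\mathcal{G}$. For a family $\mathcal{F}$ of graphs, a graph is $\mathcal{F}$-free if none of its induced subgraphs is isomorphic to a member of $\mathcal{F}$; write $\mathcal{F}\trianglelefteq\mathcal{F}'$ if every $\mathcal{F}$-free graph is $\mathcal{F}'$-free. Here $P_n$, $C_n$, $K_n$ are the path, cycle and complete graph on $n$ vertices, $+$ denotes disjoint union, $kG$ is the disjoint union of $k$ copies of $G$, the claw is $K_{1,3}$, the diamond is $K_4$ minus an edge, and the paw is a triangle with one pendant edge attached. **Theorem.** Let $\mathcal{F}$ be a family of graphs with at most four vertices such that $\mathcal{F}\neq\{4P_1,C_4\}$ and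 $\mathcal{F}\neq\{4P_1,\text{claw},C_4\}$. Then the class of $\mathcal{F}$-free graphs is tame if and only if $\mathcal{F}\trianglelefteq\mathcal{F}'$ for one of the following families $\mathcal{F}'$: 1. $\mathcal{F}'=\{P_4\}$ or $\mathcal{F}'=\{2P_2\}$; 2. $\mathcal{F}'=\{F,\text{paw}\}$ for some $F\in\{4P_1,\,P_2+2P_1,\,P_3+P_1,\,\text{claw}\}$; 3. $\mathcal{F}'=\{F,K_3+P_1\}$ for some $F\in\{4P_1,\,P_2+2P_1,\,P_3+P_1,\,\text{claw}\}$; 4. $\mathcal{F}'=\{F,K_4\}$ for some $F\in\{4P_1,\,P_2+2P_1,\,P_3+P_1\}$; 5. $\mathcal{F}'=\{F,C_4\}$ for some $F\in\{P_2+2P_1,\,P_3+P_1\}$; 6. $\mathcal{F}'=\{4P_1,C_4,\text{diamond}\}$. -/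

import Mathlib

namespace MinSep

/-- A finite, simple, undirected graph with at least one vertex. -/
structure FinGraph where
  /-- the vertex set -/
  V : Type
  [finite : Finite V]
  [nonempty : Nonempty V]
  /-- the adjacency relation -/
  graph : SimpleGraph V

attribute [instance] FinGraph.finite FinGraph.nonempty

/-- `S` is an `a,b`-separator of `G`: it avoids `a` and `b`, and `a` and `b` lie in different
connected components of `G - S`. -/
def IsSeparator {V : Type*} (G : SimpleGraph V) (a b : V) (S : Set V) : Prop :=
  ∃ (ha : a ∈ Sᶜ) (hb : b ∈ Sᶜ), ¬ (G.induce Sᶜ).Reachable ⟨a, ha⟩ ⟨b, hb⟩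

/-- `S` is a minimal separator of `G`: an inclusion-minimal `a,b`-separator for some pair of
distinct non-adjacent vertices `a`, `b`. -/
def IsMinimalSeparator {V : Type*} (G : SimpleGraph V) (S : Set V) : Prop :=
  ∃ a b : V, a ≠ b ∧ ¬ G.Adj a b ∧ Minimal (IsSeparator G a b) S

/-- The number `s(G)` of minimal separators of `G`. -/
noncomputable def numMinSep (G : FinGraph) : ℕ :=
  {S : Set G.V | IsMinimalSeparator G.graph S}.ncard

/-- A graph class is tame if the number of minimal separators of its members is bounded by
a real polynomial in the number of vertices. -/
def Tame (𝒢 : Set FinGraph) : Prop :=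
  ∃ p : Polynomial ℝ, ∀ G ∈ 𝒢, (numMinSep G : ℝ) ≤ p.eval (Nat.card G.V : ℝ)

/-- The class of `ℱ`-free graphs: no induced subgraph is isomorphic to a member of `ℱ`. -/
def freeClass (ℱ : Set FinGraph) : Set FinGraph :=
  {G | ∀ F ∈ ℱ, ¬ F.graph.IsIndContained G.graph}

/-- `ℱ ⊴ ℱ'`: every `ℱ`-free graph is `ℱ'`-free. -/
def FreeLE (ℱ ℱ' : Set FinGraph) : Prop :=
  freeClass ℱ ⊆ freeClass ℱ'

/-- Two families of graphs are equal up to isomorphism of their members. -/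
def SameFamily (ℱ ℱ' : Set FinGraph) : Prop :=
  (∀ G ∈ ℱ, ∃ H ∈ ℱ', Nonempty (G.graph ≃g H.graph)) ∧
    ∀ H ∈ ℱ', ∃ G ∈ ℱ, Nonempty (G.graph ≃g H.graph)

/-- `P₄`, the path on four vertices. -/
def P4 : FinGraph := ⟨Fin 4, SimpleGraph.pathGraph 4⟩

/-- `2P₂`, the disjoint union of two edges. -/
def twoP2 : FinGraph :=
  ⟨Fin 2 ⊕ Fin 2, SimpleGraph.sum (SimpleGraph.pathGraph 2) (SimpleGraph.pathGraph 2)⟩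

/-- `4P₁`, the edgeless graph on four vertices. -/
def fourP1 : FinGraph := ⟨Fin 4, ⊥⟩

/-- `P₂ + 2P₁`. -/
def P2add2P1 : FinGraph :=
  ⟨Fin 2 ⊕ Fin 2, SimpleGraph.sum (SimpleGraph.pathGraph 2) ⊥⟩

/-- `P₃ + P₁`. -/
def P3addP1 : FinGraph :=
  ⟨Fin 3 ⊕ Fin 1, SimpleGraph.sum (SimpleGraph.pathGraph 3) ⊥⟩

/-- The claw `K_{1,3}`. -/
def claw : FinGraph := ⟨Fin 1 ⊕ Fin 3, completeBipartiteGraph (Fin 1) (Fin 3)⟩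

/-- `K₃ + P₁`. -/
def K3addP1 : FinGraph := ⟨Fin 3 ⊕ Fin 1, SimpleGraph.sum ⊤ ⊥⟩

/-- The complete graph `K₄`. -/
def K4 : FinGraph := ⟨Fin 4, ⊤⟩

/-- The cycle `C₄`. -/
def C4 : FinGraph := ⟨Fin 4, SimpleGraph.cycleGraph 4⟩

/-- The diamond: `K₄` minus an edge. -/
def diamond : FinGraph := ⟨Fin 4, (⊤ : SimpleGraph (Fin 4)).deleteEdges {s(0, 1)}⟩

/-- The paw: a triangle `0, 1, 2` with a pendant edge from `2` to `3`. -/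
def paw : FinGraph :=
  ⟨Fin 4, SimpleGraph.fromEdgeSet {s(0, 1), s(1, 2), s(0, 2), s(2, 3)}⟩

/-- The list of maximal tame families. -/
def IsListed (ℱ' : Set FinGraph) : Prop :=
  (ℱ' = {P4} ∨ ℱ' = {twoP2}) ∨
  (∃ F ∈ ({fourP1, P2add2P1, P3addP1, claw} : Set FinGraph), ℱ' = {F, paw}) ∨
  (∃ F ∈ ({fourP1, P2add2P1, P3addP1, claw} : Set FinGraph), ℱ' = {F, K3addP1}) ∨
  (∃ F ∈ ({fourP1, P2add2P1, P3addP1} : Set FinGraph), ℱ' = {F, K4}) ∨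
  (∃ F ∈ ({P2add2P1, P3addP1} : Set FinGraph), ℱ' = {F, C4}) ∨
  ℱ' = {fourP1, C4, diamond}

end MinSep

/-
A minimal separator is the neighbourhood of each of two components of its complement, so it can be
counted through its full components. If every minimal separator of a graph in the class is
determined by the adjacencies of a bounded number `K` of vertices, then there are at most
polynomially many of them; for each listed family a bounded set of this kind comes from a Ramsey
argument inside the full components. Conversely, the theta graphs, the prisms and the line graphs
of ladders have exponentially many minimal separators, since choosing one of two vertices on each
of `k` disjoint connections between two sides always gives one. A tame class of `ℱ`-free graphs
excludes some member of each of these three sequences, and comparing the graphs on four vertices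
that the three sequences contain leaves only the listed families and the two exceptional ones.
-/

namespace MinSep

open SimpleGraph

section FourVertices

variable {V W : Type*} {G : SimpleGraph V}

theorem isIndContained_of_nodup {H : SimpleGraph W} {u : Fin 4 → W} (hu : u.Surjective)
    (a b c d : V) (hv : [a, b, c, d].Nodup)
    (h : ∀ i j, i < j → (G.Adj (![a, b, c, d] i) (![a, b, c, d] j) ↔ H.Adj (u i) (u j))) :
    H ⊴ G := by
  set v := ![a, b, c, d]
  have v_injective : v.Injective := List.nodup_ofFn.1 hv
  have adj_iff (i j) : G.Adj (v i) (v j) ↔ H.Adj (u i) (u j) := by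
    obtain hij | rfl | hji := lt_trichotomy i j
    · exact h i j hij
    · simp only [SimpleGraph.irrefl]
    · rw [G.adj_comm, H.adj_comm]
      exact h j i hji
  refine ⟨⟨v ∘ Function.surjInv hu, v_injective.comp (Function.injective_surjInv hu)⟩, ?_⟩
  simp [adj_iff, Function.surjInv_eq]

variable {a b c d : V}

theorem fourP1_isIndContained (hne : [a, b, c, d].Nodup) (hab : ¬ G.Adj a b) (hac : ¬ G.Adj a c)
    (had : ¬ G.Adj a d) (hbc : ¬ G.Adj b c) (hbd : ¬ G.Adj b d) (hcd : ¬ G.Adj c d) :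
    fourP1.graph ⊴ G :=
  isIndContained_of_nodup (H := (⊥ : SimpleGraph (Fin 4))) Function.surjective_id a b c d hne
    (by simp [Fin.forall_fin_succ, *])

theorem P2add2P1_isIndContained (hab : G.Adj a b) (hac : ¬ G.Adj a c) (had : ¬ G.Adj a d)
    (hbc : ¬ G.Adj b c) (hbd : ¬ G.Adj b d) (hcd : ¬ G.Adj c d) (hne : c ≠ d) :
    P2add2P1.graph ⊴ G :=
  isIndContained_of_nodup (H := pathGraph 2 ⊕g ⊥) (u := ![.inl 0, .inl 1, .inr 0, .inr 1])
    (by decide) a b c d (by grind [SimpleGraph.irrefl, SimpleGraph.adj_comm])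
    (by simp [Fin.forall_fin_succ, pathGraph_adj, *])

theorem twoP2_isIndContained (hab : G.Adj a b) (hcd : G.Adj c d) (hac : ¬ G.Adj a c)
    (had : ¬ G.Adj a d) (hbc : ¬ G.Adj b c) (hbd : ¬ G.Adj b d) : twoP2.graph ⊴ G :=
  isIndContained_of_nodup (H := pathGraph 2 ⊕g pathGraph 2)
    (u := ![.inl 0, .inl 1, .inr 0, .inr 1]) (by decide) a b c d
    (by grind [SimpleGraph.irrefl, SimpleGraph.adj_comm])
    (by simp [Fin.forall_fin_succ, pathGraph_adj, *])

theorem P3addP1_isIndContained (hab : G.Adj a b) (hbc : G.Adj b c) (hac : ¬ G.Adj a c)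
    (had : ¬ G.Adj a d) (hbd : ¬ G.Adj b d) (hcd : ¬ G.Adj c d) (hne : a ≠ c) :
    P3addP1.graph ⊴ G :=
  isIndContained_of_nodup (H := pathGraph 3 ⊕g ⊥) (u := ![.inl 0, .inl 1, .inl 2, .inr 0])
    (by decide) a b c d (by grind [SimpleGraph.irrefl, SimpleGraph.adj_comm])
    (by simp [Fin.forall_fin_succ, pathGraph_adj, *])

theorem claw_isIndContained (hab : G.Adj a b) (hac : G.Adj a c) (had : G.Adj a d)
    (hbc : ¬ G.Adj b c) (hbd : ¬ G.Adj b d) (hcd : ¬ G.Adj c d) (hne : [b, c, d].Nodup) :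
    claw.graph ⊴ G :=
  isIndContained_of_nodup (H := completeBipartiteGraph (Fin 1) (Fin 3))
    (u := ![.inl 0, .inr 0, .inr 1, .inr 2]) (by decide) a b c d
    (by grind [SimpleGraph.irrefl, SimpleGraph.adj_comm])
    (by simp [Fin.forall_fin_succ, *])

theorem P4_isIndContained (hab : G.Adj a b) (hbc : G.Adj b c) (hcd : G.Adj c d)
    (hac : ¬ G.Adj a c) (had : ¬ G.Adj a d) (hbd : ¬ G.Adj b d) : P4.graph ⊴ G :=
  isIndContained_of_nodup (H := pathGraph 4) Function.surjective_id a b c d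
    (by grind [SimpleGraph.irrefl, SimpleGraph.adj_comm])
    (by simp [Fin.forall_fin_succ, pathGraph_adj, *])

theorem K3addP1_isIndContained (hab : G.Adj a b) (hac : G.Adj a c) (hbc : G.Adj b c)
    (had : ¬ G.Adj a d) (hbd : ¬ G.Adj b d) (hcd : ¬ G.Adj c d) : K3addP1.graph ⊴ G :=
  isIndContained_of_nodup (H := (⊤ : SimpleGraph (Fin 3)) ⊕g ⊥)
    (u := ![.inl 0, .inl 1, .inl 2, .inr 0]) (by decide) a b c d
    (by grind [SimpleGraph.irrefl, SimpleGraph.adj_comm])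
    (by simp [Fin.forall_fin_succ, *])

theorem C4_isIndContained (hab : G.Adj a b) (hbc : G.Adj b c) (hcd : G.Adj c d)
    (hda : G.Adj d a) (hac : ¬ G.Adj a c) (hbd : ¬ G.Adj b d) (hne : a ≠ c) (hne' : b ≠ d) :
    C4.graph ⊴ G :=
  isIndContained_of_nodup (H := cycleGraph 4) Function.surjective_id a b c d
    (by grind [SimpleGraph.irrefl, SimpleGraph.adj_comm])
    (by simp +decide [Fin.forall_fin_succ, cycleGraph_adj, hda.symm, *])

theorem paw_isIndContained (hab : G.Adj a b) (hac : G.Adj a c) (hbc : G.Adj b c)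
    (hcd : G.Adj c d) (had : ¬ G.Adj a d) (hbd : ¬ G.Adj b d) : paw.graph ⊴ G :=
  isIndContained_of_nodup (H := fromEdgeSet (V := Fin 4) {s(0, 1), s(1, 2), s(0, 2), s(2, 3)})
    Function.surjective_id a b c d (by grind [SimpleGraph.irrefl, SimpleGraph.adj_comm])
    (by simp [Fin.forall_fin_succ, *])

theorem diamond_isIndContained (hab : ¬ G.Adj a b) (hac : G.Adj a c) (had : G.Adj a d)
    (hbc : G.Adj b c) (hbd : G.Adj b d) (hcd : G.Adj c d) (hne : a ≠ b) : diamond.graph ⊴ G :=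
  isIndContained_of_nodup (H := (⊤ : SimpleGraph (Fin 4)).deleteEdges {s(0, 1)})
    Function.surjective_id a b c d (by grind [SimpleGraph.irrefl, SimpleGraph.adj_comm])
    (by simp [Fin.forall_fin_succ, *])

theorem K4_isIndContained (hab : G.Adj a b) (hac : G.Adj a c) (had : G.Adj a d)
    (hbc : G.Adj b c) (hbd : G.Adj b d) (hcd : G.Adj c d) : K4.graph ⊴ G :=
  isIndContained_of_nodup (H := (⊤ : SimpleGraph (Fin 4))) Function.surjective_id a b c d
    (by grind [SimpleGraph.irrefl]) (by simp [Fin.forall_fin_succ, *])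

/-- The eleven graphs on four vertices. -/
def fourVertexGraphs : Set FinGraph :=
  {fourP1, P2add2P1, twoP2, P3addP1, claw, P4, K3addP1, C4, paw, diamond, K4}

theorem card_of_mem_fourVertexGraphs {H : FinGraph} (hH : H ∈ fourVertexGraphs) :
    Nat.card H.V = 4 := by
  rcases hH with rfl | rfl | rfl | rfl | rfl | rfl | rfl | rfl | rfl | rfl | rfl <;>
    simp [fourP1, P2add2P1, twoP2, P3addP1, claw, P4, K3addP1, C4, paw, diamond, K4]

/-- The symmetric Boolean matrix with zero diagonal and the given entries above it: the adjacency
matrix of a graph on `Fin 4` in a form that `decide` can enumerate. -/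
def adjTable (b01 b02 b03 b12 b13 b23 : Bool) (i j : Fin 4) : Bool :=
  match i, j with
  | 0, 1 | 1, 0 => b01
  | 0, 2 | 2, 0 => b02
  | 0, 3 | 3, 0 => b03
  | 1, 2 | 2, 1 => b12
  | 1, 3 | 3, 1 => b13
  | 2, 3 | 3, 2 => b23
  | _, _ => false

/-- The entries above the diagonal, row by row, of adjacency matrices of the eleven graphs on four
vertices, in the order of `fourVertexGraphs` and of the arguments of the lemmas recognizing them. -/
def fourVertexTables : List (Bool × Bool × Bool × Bool × Bool × Bool) :=
  [(false, false, false, false, false, false),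
   (true, false, false, false, false, false),
   (true, false, false, false, false, true),
   (true, false, false, true, false, false),
   (true, true, true, false, false, false),
   (true, false, false, true, false, true),
   (true, true, false, true, false, false),
   (true, false, true, true, false, true),
   (true, true, false, true, false, true),
   (false, true, true, true, true, true),
   (true, true, true, true, true, true)]

theorem exists_perm_mem_fourVertexTables (b01 b02 b03 b12 b13 b23 : Bool) :
    let r := adjTable b01 b02 b03 b12 b13 b23
    ∃ i j k l, [i, j, k, l].Nodup ∧
      (r i j, r i k, r i l, r j k, r j l, r k l) ∈ fourVertexTables := by
  revert b01 b02 b03 b12 b13 b23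
  decide +kernel

theorem exists_fourVertexGraph_isIndContained (v : Fin 4 ↪ V) :
    ∃ H ∈ fourVertexGraphs, H.graph ⊴ G := by
  classical
  let r (i j : Fin 4) : Bool := G.Adj (v i) (v j)
  obtain ⟨i, j, k, l, hne, ht⟩ :=
    exists_perm_mem_fourVertexTables (r 0 1) (r 0 2) (r 0 3) (r 1 2) (r 1 3) (r 2 3)
  have r_self (x) : false = r x x := by simp [r]
  have r_symm (x y) : r x y = r y x := by simp only [r, G.adj_comm]
  have adjTable_eq : adjTable (r 0 1) (r 0 2) (r 0 3) (r 1 2) (r 1 3) (r 2 3) = r := by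
    ext x y
    fin_cases x <;> fin_cases y <;> first | rfl | exact r_self _ | exact r_symm _ _
  replace hne : [v i, v j, v k, v l].Nodup := hne.map v.injective
  simp only [adjTable_eq, fourVertexTables, List.mem_cons, List.not_mem_nil, or_false,
    Prod.mk.injEq, r, decide_eq_true_eq, decide_eq_false_iff_not] at ht
  unfold fourVertexGraphs
  rcases ht with h | h | h | h | h | h | h | h | h | h | h <;> obtain ⟨h₁, h₂, h₃, h₄, h₅, h₆⟩ := h
  · exact ⟨fourP1, by simp, fourP1_isIndContained hne h₁ h₂ h₃ h₄ h₅ h₆⟩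
  · exact ⟨P2add2P1, by simp, P2add2P1_isIndContained h₁ h₂ h₃ h₄ h₅ h₆ (by grind)⟩
  · exact ⟨twoP2, by simp, twoP2_isIndContained h₁ h₆ h₂ h₃ h₄ h₅⟩
  · exact ⟨P3addP1, by simp, P3addP1_isIndContained h₁ h₄ h₂ h₃ h₅ h₆ (by grind)⟩
  · exact ⟨claw, by simp, claw_isIndContained h₁ h₂ h₃ h₄ h₅ h₆ hne.of_cons⟩
  · exact ⟨P4, by simp, P4_isIndContained h₁ h₄ h₆ h₂ h₃ h₅⟩
  · exact ⟨K3addP1, by simp, K3addP1_isIndContained h₁ h₂ h₄ h₃ h₅ h₆⟩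
  · exact ⟨C4, by simp, C4_isIndContained h₁ h₄ h₆ h₃.symm h₂ h₅ (by grind) (by grind)⟩
  · exact ⟨paw, by simp, paw_isIndContained h₁ h₂ h₄ h₆ h₃ h₅⟩
  · exact ⟨diamond, by simp, diamond_isIndContained h₁ h₂ h₃ h₄ h₅ h₆ (by grind)⟩
  · exact ⟨K4, by simp, K4_isIndContained h₁ h₂ h₃ h₄ h₅ h₆⟩

theorem nonempty_iso_of_isIndContained [Finite V] {H : SimpleGraph W} (h : H ⊴ G)
    (hcard : Nat.card V = Nat.card W) : Nonempty (H ≃g G) := by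
  obtain ⟨f⟩ := h
  have f_bijective : Function.Bijective f :=
    (Nat.bijective_iff_injective_and_card f).2 ⟨f.injective, hcard.symm⟩
  exact ⟨⟨Equiv.ofBijective f f_bijective, f.map_rel_iff⟩⟩

theorem exists_fourVertexGraph_between [Finite V] {F : SimpleGraph W}
    (h : F ⊴ G) (hF : Nat.card W ≤ 4) (hG : 4 ≤ Nat.card V) :
    ∃ H ∈ fourVertexGraphs, F ⊴ H.graph ∧ H.graph ⊴ G := by
  obtain ⟨f⟩ := h
  obtain ⟨X, hfX, -, hX⟩ := Set.exists_subsuperset_card_eq (Set.subset_univ (Set.range f))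
    (n := 4) (by rwa [← Nat.card_coe_set_eq, Nat.card_range_of_injective f.injective])
    (by rwa [Set.ncard_univ])
  rw [← Nat.card_coe_set_eq] at hX
  let e : Fin 4 ≃ X := (Finite.equivFinOfCardEq hX).symm
  obtain ⟨H, hH, hHX⟩ := exists_fourVertexGraph_isIndContained (G := G.induce X) e.toEmbedding
  obtain ⟨i⟩ := nonempty_iso_of_isIndContained hHX
    (hX.trans (card_of_mem_fourVertexGraphs hH).symm)
  refine ⟨H, hH, ?_, hHX.trans ⟨Embedding.induce _⟩⟩
  have f_induce : F ↪g G.induce X :=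
    ⟨⟨fun w => ⟨f w, hfX ⟨w, rfl⟩⟩, fun x y hxy => f.injective (congrArg Subtype.val hxy)⟩,
      f.map_rel_iff⟩
  exact ⟨i.symm.toEmbedding.comp f_induce⟩

end FourVertices

section FullComponents

variable {V : Type*} {G : SimpleGraph V} {S A B : Set V}

theorem exists_adj_mem_notMem_of_reachable {u v : V} {X : Set V} (h : G.Reachable u v)
    (hu : u ∈ X) (hv : v ∉ X) : ∃ x ∈ X, ∃ y ∉ X, G.Adj x y := by
  obtain ⟨p⟩ := h
  obtain ⟨d, -, hd, hd'⟩ := p.exists_boundary_dart X hu hv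
  exact ⟨d.fst, hd, d.snd, hd', d.adj⟩

theorem exists_adj_mem_notMem_of_preconnected_induce {X : Set V}
    (h : (G.induce A).Preconnected) (hX : (A ∩ X).Nonempty) (hX' : (A \ X).Nonempty) :
    ∃ x ∈ A ∩ X, ∃ y ∈ A \ X, G.Adj x y := by
  obtain ⟨u, huA, huX⟩ := hX
  obtain ⟨v, hvA, hvX⟩ := hX'
  obtain ⟨x, hx, y, hy, hxy⟩ := exists_adj_mem_notMem_of_reachable (h ⟨u, huA⟩ ⟨v, hvA⟩)
    (X := Subtype.val ⁻¹' X) huX hvX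
  exact ⟨x, ⟨x.2, hx⟩, y, ⟨y.2, hy⟩, hxy⟩

/-- `A` is the vertex set of a full component of `G - S`, that is, of a component in which every
vertex of `S` has a neighbour. -/
structure IsFullComponent (G : SimpleGraph V) (S A : Set V) : Prop where
  disjoint : Disjoint S A
  connected : (G.induce A).Connected
  mem_of_adj : ∀ ⦃a⦄, a ∈ A → ∀ ⦃v⦄, G.Adj a v → v ∉ S → v ∈ A
  exists_adj : ∀ ⦃s⦄, s ∈ S → ∃ a ∈ A, G.Adj s a

/-- `A` and `B` are two different full components of `G - S`. -/
structure IsFullPair (G : SimpleGraph V) (S A B : Set V) : Prop where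
  left : IsFullComponent G S A
  right : IsFullComponent G S B
  disjoint : Disjoint A B

theorem IsFullComponent.nonempty (h : IsFullComponent G S A) : A.Nonempty :=
  Set.nonempty_coe_sort.1 h.connected.nonempty

namespace IsFullPair

theorem symm (h : IsFullPair G S A B) : IsFullPair G S B A :=
  ⟨h.right, h.left, h.disjoint.symm⟩

theorem not_adj (h : IsFullPair G S A B) {a b : V} (ha : a ∈ A) (hb : b ∈ B) : ¬ G.Adj a b :=
  fun hab => h.disjoint.notMem_of_mem_right hb
    (h.left.mem_of_adj ha hab (h.right.disjoint.notMem_of_mem_right hb))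

theorem not_adj' (h : IsFullPair G S A B) {a b : V} (ha : a ∈ A) (hb : b ∈ B) : ¬ G.Adj b a :=
  h.symm.not_adj hb ha

theorem ne (h : IsFullPair G S A B) {a b : V} (ha : a ∈ A) (hb : b ∈ B) : a ≠ b :=
  h.disjoint.ne_of_mem ha hb

end IsFullPair

theorem isSeparator_comm {a b : V} : IsSeparator G a b S ↔ IsSeparator G b a S := by
  simp only [IsSeparator, reachable_comm]
  exact exists_comm

theorem isFullComponent_connectedComponent {a b : V} (h : Minimal (IsSeparator G a b) S)
    (ha : a ∈ Sᶜ) :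
    IsFullComponent G S (Subtype.val '' ((G.induce Sᶜ).connectedComponentMk ⟨a, ha⟩).supp) := by
  set C := (G.induce Sᶜ).connectedComponentMk ⟨a, ha⟩
  have mem_of_adj : ∀ ⦃x⦄, x ∈ Subtype.val '' C.supp → ∀ ⦃y⦄, G.Adj x y → y ∉ S →
      y ∈ Subtype.val '' C.supp := by
    rintro - ⟨x, hx, rfl⟩ y hxy hy
    exact ⟨⟨y, hy⟩, C.mem_supp_of_adj_mem_supp hx hxy, rfl⟩
  refine ⟨?_, ?_, mem_of_adj, fun s hs => ?_⟩
  · rw [Set.disjoint_right]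
    rintro - ⟨x, -, rfl⟩
    exact x.2
  · let f : C.toSimpleGraph →g G.induce (Subtype.val '' C.supp) :=
      ⟨fun x => ⟨x.1, x.1, x.2, rfl⟩, id⟩
    refine C.connected_toSimpleGraph.map f ?_
    rintro ⟨-, x, hx, rfl⟩
    exact ⟨⟨x, hx⟩, rfl⟩
  · by_contra! hs'
    obtain ⟨_, hb, hab⟩ := h.prop
    have isSeparator_diff : IsSeparator G a b (S \ {s}) := by
      refine ⟨fun h => ha h.1, fun h => hb h.1, fun hr => ?_⟩
      obtain ⟨⟨x, _⟩, hx, ⟨y, hyS'⟩, hy, hxy⟩ := exists_adj_mem_notMem_of_reachable hr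
        (X := Subtype.val ⁻¹' (Subtype.val '' C.supp)) ⟨⟨a, ha⟩, rfl, rfl⟩
        (by rintro ⟨z, hz, rfl⟩; exact hab (ConnectedComponent.exact hz).symm)
      have hyS : y ∈ S := by
        by_contra hyS
        exact hy (mem_of_adj hx hxy hyS)
      have hys : y = s := by
        by_contra hys
        exact hyS' ⟨hyS, hys⟩
      have hyx : G.Adj y x := Adj.symm hxy
      exact hs' x hx (hys ▸ hyx)
    exact (h.le_of_le isSeparator_diff Set.sdiff_subset hs).2 rfl

theorem IsFullPair.isSeparator (h : IsFullPair G S A B) {a b : V} (ha : a ∈ A) (hb : b ∈ B) :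
    IsSeparator G a b S := by
  refine ⟨h.left.disjoint.notMem_of_mem_right ha, h.right.disjoint.notMem_of_mem_right hb,
    fun hr => ?_⟩
  obtain ⟨x, hx, y, hy, hxy⟩ := exists_adj_mem_notMem_of_reachable hr
    (X := Subtype.val ⁻¹' A) ha (h.disjoint.notMem_of_mem_right hb)
  exact hy (h.left.mem_of_adj hx hxy y.2)

theorem IsFullComponent.reachable (h : IsFullComponent G S A) {T : Set V} (hTS : T ⊆ S) {a s : V}
    (ha : a ∈ A) (hs : s ∈ S) (hsT : s ∈ Tᶜ) :
    (G.induce Tᶜ).Reachable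
      ⟨a, fun haT => h.disjoint.notMem_of_mem_right ha (hTS haT)⟩ ⟨s, hsT⟩ := by
  have hAT : A ⊆ Tᶜ := fun x hx hxT => h.disjoint.notMem_of_mem_right hx (hTS hxT)
  obtain ⟨a', ha', hsa'⟩ := h.exists_adj hs
  have hr := (h.connected.preconnected ⟨a, ha⟩ ⟨a', ha'⟩).map (G.induceHomOfLE hAT).toHom
  exact hr.trans (Adj.reachable (G := G.induce Tᶜ) hsa'.symm)

theorem IsFullPair.isMinimalSeparator (h : IsFullPair G S A B) : IsMinimalSeparator G S := by
  obtain ⟨a, ha⟩ := h.left.nonempty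
  obtain ⟨b, hb⟩ := h.right.nonempty
  refine ⟨a, b, h.ne ha hb, h.not_adj ha hb, h.isSeparator ha hb, ?_⟩
  rintro T ⟨haT, hbT, hT⟩ hTS s hs
  by_contra hsT
  exact hT ((h.left.reachable hTS ha hs hsT).trans (h.right.reachable hTS hb hs hsT).symm)

theorem isMinimalSeparator_iff_exists_isFullPair :
    IsMinimalSeparator G S ↔ ∃ A B, IsFullPair G S A B := by
  refine ⟨?_, fun ⟨A, B, h⟩ => h.isMinimalSeparator⟩
  rintro ⟨a, b, -, -, hmin⟩
  obtain ⟨ha, hb, hab⟩ := hmin.prop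
  have hmin' : Minimal (IsSeparator G b a) S := by
    simpa only [Minimal, isSeparator_comm (a := b)] using hmin
  refine ⟨_, _, isFullComponent_connectedComponent hmin ha,
    isFullComponent_connectedComponent hmin' hb, ?_⟩
  rw [Set.disjoint_image_iff Subtype.val_injective]
  exact pairwise_disjoint_supp_connectedComponent _
    fun hC => hab (ConnectedComponent.exact hC)

end FullComponents

section Determined

variable {V : Type*} {G : SimpleGraph V} {S A B : Set V} {K L : ℕ}

/-- Membership in `S` depends only on adjacency and equality to at most `K` vertices. A class of
graphs whose minimal separators all have this property for one `K` is tame. -/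
def IsDetermined (G : SimpleGraph V) (K : ℕ) (S : Set V) : Prop :=
  ∃ X : Set V, X.encard ≤ K ∧
    ∀ v w, (∀ x ∈ X, (G.Adj v x ↔ G.Adj w x) ∧ (v = x ↔ w = x)) → v ∈ S → w ∈ S

theorem exists_subset_range_of_encard_le [Nonempty V] {X : Set V} (hX : X.encard ≤ K) :
    ∃ x : Fin K → V, X ⊆ Set.range x := by
  obtain ⟨hfin, hcard⟩ := Set.encard_le_coe_iff_finite_ncard_le.1 hX
  have := hfin.fintype
  obtain ⟨e⟩ : Nonempty (X ↪ Fin K) := Function.Embedding.nonempty_of_card_le (by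
    rwa [Fintype.card_fin, ← Nat.card_eq_fintype_card, Nat.card_coe_set_eq])
  exact ⟨Function.extend e (↑) fun _ => Classical.arbitrary V,
    fun v hv => ⟨e ⟨v, hv⟩, e.injective.extend_apply _ _ _⟩⟩

theorem ncard_setOf_isDetermined_le [Finite V] [Nonempty V] (G : SimpleGraph V) (K : ℕ) :
    {S : Set V | IsDetermined G K S}.ncard ≤ 2 ^ 4 ^ K * Nat.card V ^ K := by
  let trace (x : Fin K → V) (v : V) (i : Fin K) : Prop × Prop := (G.Adj v (x i), v = x i)
  let f (p : (Fin K → V) × Set (Fin K → Prop × Prop)) : Set V := trace p.1 ⁻¹' p.2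
  have subset_range : {S : Set V | IsDetermined G K S} ⊆ Set.range f := by
    rintro S ⟨X, hX, hS⟩
    obtain ⟨x, hx⟩ := exists_subset_range_of_encard_le hX
    refine ⟨(x, trace x '' S), Set.Subset.antisymm ?_ (Set.subset_preimage_image _ _)⟩
    rintro w ⟨v, hv, hvw⟩
    refine hS v w (fun y hy => ?_) hv
    obtain ⟨i, rfl⟩ := hx hy
    have hi := Prod.mk.inj (congrFun hvw i)
    exact ⟨iff_of_eq hi.1, iff_of_eq hi.2⟩
  calc {S : Set V | IsDetermined G K S}.ncard
      ≤ (f '' Set.univ).ncard := Set.ncard_le_ncard (Set.image_univ ▸ subset_range)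
    _ ≤ Nat.card ((Fin K → V) × Set (Fin K → Prop × Prop)) :=
        Set.ncard_univ _ ▸ Set.ncard_image_le
    _ = 2 ^ 4 ^ K * Nat.card V ^ K := by
        have := Fintype.ofFinite V
        simp [Nat.card_eq_fintype_card, mul_comm]

theorem tame_of_isDetermined {𝒢 : Set FinGraph} (K : ℕ)
    (h : ∀ G ∈ 𝒢, ∀ S A B, IsFullPair G.graph S A B → IsDetermined G.graph K S) : Tame 𝒢 := by
  refine ⟨Polynomial.C (2 ^ 4 ^ K) * Polynomial.X ^ K, fun G hG => ?_⟩
  have numMinSep_le : numMinSep G ≤ 2 ^ 4 ^ K * Nat.card G.V ^ K := by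
    refine (Set.ncard_le_ncard (fun S hS => ?_)).trans (ncard_setOf_isDetermined_le G.graph K)
    obtain ⟨A, B, hAB⟩ := isMinimalSeparator_iff_exists_isFullPair.1 hS
    exact h G hG S A B hAB
  simp only [Polynomial.eval_mul, Polynomial.eval_C, Polynomial.eval_pow, Polynomial.eval_X]
  exact_mod_cast numMinSep_le

theorem IsDetermined.mono (h : IsDetermined G K S) (hKL : K ≤ L) : IsDetermined G L S := by
  obtain ⟨X, hX, hS⟩ := h
  exact ⟨X, hX.trans (by exact_mod_cast hKL), hS⟩

theorem isDetermined_of_encard_le (hS : S.encard ≤ K) : IsDetermined G K S :=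
  ⟨S, hS, fun v _ hvw hv => (hvw v hv).2.1 rfl ▸ hv⟩

theorem IsFullComponent.isDetermined_of_encard_le (h : IsFullComponent G S A)
    (hA : A.encard ≤ K) : IsDetermined G K S := by
  refine ⟨A, hA, fun v w hvw hv => ?_⟩
  obtain ⟨a, ha, hva⟩ := h.exists_adj hv
  by_contra hw
  have hwA : w ∈ A := h.mem_of_adj ha ((hvw a ha).1.1 hva).symm hw
  exact h.disjoint.ne_of_mem hv hwA ((hvw w hwA).2.2 rfl)

theorem IsFullPair.isDetermined_of_dominating (h : IsFullPair G S A B) {X Y : Set V}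
    (hXA : X ⊆ A) (hYB : Y ⊆ B) (hX : X.encard ≤ K) (hY : Y.encard ≤ L)
    (hSX : ∀ s ∈ S, ∃ a ∈ X, G.Adj s a) (hSY : ∀ s ∈ S, ∃ b ∈ Y, G.Adj s b) :
    IsDetermined G (K + L) S := by
  refine ⟨X ∪ Y, (Set.encard_union_le X Y).trans (by push_cast; gcongr), fun v w hvw hv => ?_⟩
  obtain ⟨a, ha, hva⟩ := hSX v hv
  obtain ⟨b, hb, hvb⟩ := hSY v hv
  have hwa : G.Adj w a := (hvw a (.inl ha)).1.1 hva
  have hwb : G.Adj w b := (hvw b (.inr hb)).1.1 hvb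
  by_contra hw
  exact h.not_adj (h.left.mem_of_adj (hXA ha) hwa.symm hw) (hYB hb) hwb

end Determined

section Ramsey

variable {V : Type*} {G : SimpleGraph V} {A : Set V}

theorem cliqueFreeOn_three_iff : G.CliqueFreeOn A 3 ↔
    ∀ x ∈ A, ∀ y ∈ A, ∀ z ∈ A, G.Adj x y → G.Adj x z → ¬ G.Adj y z := by
  classical
  refine ⟨fun h x hx y hy z hz hxy hxz hyz => ?_, fun h t htA ht => ?_⟩
  · refine @h {x, y, z} ?_ (is3Clique_triple_iff.2 ⟨hxy, hxz, hyz⟩)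
    simp [Set.insert_subset_iff, hx, hy, hz]
  · obtain ⟨x, y, z, hxy, hxz, hyz, rfl⟩ := is3Clique_iff.1 ht
    exact h x (htA (by simp)) y (htA (by simp)) z (htA (by simp)) hxy hxz hyz

theorem cliqueFreeOn_one_iff : G.CliqueFreeOn A 1 ↔ A = ∅ := by
  refine ⟨fun h => Set.eq_empty_of_forall_notMem fun x hx => ?_, ?_⟩
  · exact @h {x} (by simpa using hx) (isNClique_singleton.2 rfl)
  · rintro rfl
    simp

/-- The Erdős–Szekeres bound on Ramsey numbers. -/
theorem encard_lt_choose_of_cliqueFreeOn {m n : ℕ} (hm : G.CliqueFreeOn A (m + 1))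
    (hn : Gᶜ.CliqueFreeOn A (n + 1)) : A.encard < (m + n).choose m := by
  induction hk : m + n generalizing m n A with
  | zero =>
    obtain ⟨rfl, rfl⟩ := Nat.add_eq_zero_iff.1 hk
    simp [cliqueFreeOn_one_iff.1 hm]
  | succ k ih =>
    obtain rfl | ⟨x, hx⟩ := A.eq_empty_or_nonempty
    · simpa [← hk] using Nat.choose_pos (Nat.le_add_right m n)
    obtain _ | m := m
    · simp [cliqueFreeOn_one_iff.1 hm] at hx
    obtain _ | n := n
    · simp [cliqueFreeOn_one_iff.1 hn] at hx
    have hA : A ⊆ insert x ((A ∩ G.neighborSet x) ∪ (A ∩ Gᶜ.neighborSet x)) := by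
      intro y hy
      simp only [Set.mem_insert_iff, Set.mem_union, Set.mem_inter_iff, mem_neighborSet, compl_adj]
      grind
    have hN := ih (CliqueFreeOn.of_succ _ hm hx)
      (CliqueFreeOn.subset _ Set.inter_subset_left hn) (by omega)
    have hN' := ih (CliqueFreeOn.subset _ Set.inter_subset_left hm)
      (CliqueFreeOn.of_succ _ hn hx) (by omega)
    calc A.encard ≤ (A ∩ G.neighborSet x).encard + (A ∩ Gᶜ.neighborSet x).encard + 1 :=
          (Set.encard_le_encard hA).trans <| (Set.encard_insert_le _ _).trans <|
            add_le_add_left (Set.encard_union_le _ _) 1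
      _ < (k + 1).choose (m + 1) := by
          lift (A ∩ G.neighborSet x).encard to ℕ using ne_top_of_lt hN with p
          lift (A ∩ Gᶜ.neighborSet x).encard to ℕ using ne_top_of_lt hN' with q
          rw [Nat.choose_succ_succ']
          norm_cast at hN hN' ⊢
          omega

end Ramsey

section Cliques

variable {V : Type*} {G : SimpleGraph V} {S A B : Set V}

theorem IsFullComponent.exists_adj_of_nontrivial (h : IsFullComponent G S A)
    (hA : A.Nontrivial) {a : V} (ha : a ∈ A) : ∃ x ∈ A, G.Adj a x := by
  obtain ⟨b, hb, hba⟩ := hA.exists_ne a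
  obtain ⟨_, ⟨-, rfl⟩, y, hy, hay⟩ := exists_adj_mem_notMem_of_preconnected_induce (X := {a})
    h.connected.preconnected ⟨a, ha, rfl⟩ ⟨b, hb, hba⟩
  exact ⟨y, hy.1, hay⟩

theorem IsFullComponent.exists_adj_adj_not_adj_of_not_isClique (h : IsFullComponent G S A)
    (hA : ¬ G.IsClique A) :
    ∃ x ∈ A, ∃ y ∈ A, ∃ z ∈ A, G.Adj x y ∧ G.Adj y z ∧ ¬ G.Adj x z ∧ x ≠ z := by
  simp only [isClique_iff, Set.Pairwise, not_forall] at hA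
  obtain ⟨x, hx, w, hw, hxw, hadj⟩ := hA
  obtain ⟨y, ⟨hy, hxy⟩, z, ⟨hz, hxz⟩, hyz⟩ := exists_adj_mem_notMem_of_preconnected_induce
    (X := {v | v = x ∨ G.Adj x v}) h.connected.preconnected ⟨x, hx, .inl rfl⟩
    ⟨w, hw, by rintro (rfl | hxw') <;> contradiction⟩
  obtain ⟨hzx, hxz⟩ := not_or.1 hxz
  obtain rfl | hxy := hxy
  · exact absurd hyz hxz
  · exact ⟨x, hx, y, hy, z, hz, hxy, hyz, hxz, Ne.symm hzx⟩

namespace IsFullPair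

theorem adj_of_P4_free (h : IsFullPair G S A B) (hG : ¬ P4.graph ⊴ G) {s a : V}
    (hs : s ∈ S) (ha : a ∈ A) : G.Adj s a := by
  by_contra hsa
  obtain ⟨a', ha', hsa'⟩ := h.left.exists_adj hs
  obtain ⟨b, hb, hsb⟩ := h.right.exists_adj hs
  obtain ⟨x, ⟨hx, hsx⟩, y, ⟨hy, hsy⟩, hxy⟩ := exists_adj_mem_notMem_of_preconnected_induce
    (X := G.neighborSet s) h.left.connected.preconnected ⟨a', ha', hsa'⟩ ⟨a, ha, hsa⟩
  exact hG (P4_isIndContained hsb.symm hsx hxy (h.not_adj' hx hb) (h.not_adj' hy hb) hsy)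

theorem isDetermined_of_P4_free (h : IsFullPair G S A B) (hG : ¬ P4.graph ⊴ G) :
    IsDetermined G (1 + 1) S := by
  obtain ⟨a, ha⟩ := h.left.nonempty
  obtain ⟨b, hb⟩ := h.right.nonempty
  exact h.isDetermined_of_dominating (Set.singleton_subset_iff.2 ha)
    (Set.singleton_subset_iff.2 hb) (Set.encard_singleton a).le (Set.encard_singleton b).le
    (fun s hs => ⟨a, rfl, h.adj_of_P4_free hG hs ha⟩)
    (fun s hs => ⟨b, rfl, h.symm.adj_of_P4_free hG hs hb⟩)

theorem encard_le_one_of_twoP2_free (h : IsFullPair G S A B) (hG : ¬ twoP2.graph ⊴ G) :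
    A.encard ≤ 1 ∨ B.encard ≤ 1 := by
  simp only [Set.encard_le_one_iff_subsingleton, ← Set.not_nontrivial_iff, ← not_and_or]
  rintro ⟨hA, hB⟩
  obtain ⟨a, ha⟩ := h.left.nonempty
  obtain ⟨b, hb⟩ := h.right.nonempty
  obtain ⟨x, hx, hax⟩ := h.left.exists_adj_of_nontrivial hA ha
  obtain ⟨y, hy, hby⟩ := h.right.exists_adj_of_nontrivial hB hb
  exact hG (twoP2_isIndContained hax hby (h.not_adj ha hb) (h.not_adj ha hy) (h.not_adj hx hb)
    (h.not_adj hx hy))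

theorem isClique_of_P3addP1_free (h : IsFullPair G S A B) (hG : ¬ P3addP1.graph ⊴ G) :
    G.IsClique A := by
  by_contra hA
  obtain ⟨x, hx, y, hy, z, hz, hxy, hyz, hxz, hne⟩ :=
    h.left.exists_adj_adj_not_adj_of_not_isClique hA
  obtain ⟨b, hb⟩ := h.right.nonempty
  exact hG (P3addP1_isIndContained hxy hyz hxz (h.not_adj hx hb) (h.not_adj hy hb)
    (h.not_adj hz hb) hne)

theorem isClique_of_P2add2P1_free (h : IsFullPair G S A B) (hG : ¬ P2add2P1.graph ⊴ G)
    (hB : B.Nontrivial) : G.IsClique A := by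
  obtain ⟨b, hb⟩ := h.right.nonempty
  obtain ⟨y, hy, hby⟩ := h.right.exists_adj_of_nontrivial hB hb
  intro x hx z hz hxz
  by_contra hadj
  exact hG (P2add2P1_isIndContained hby (h.not_adj' hx hb) (h.not_adj' hz hb) (h.not_adj' hx hy)
    (h.not_adj' hz hy) hadj hxz)

theorem isClique_of_P2add2P1_or_P3addP1_free (h : IsFullPair G S A B)
    (hG : ¬ P2add2P1.graph ⊴ G ∨ ¬ P3addP1.graph ⊴ G) (hB : 1 < B.encard) : G.IsClique A :=
  hG.elim (h.isClique_of_P2add2P1_free · (Set.one_lt_encard_iff_nontrivial.1 hB))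
    h.isClique_of_P3addP1_free

theorem compl_cliqueFreeOn_of_fourP1_free (h : IsFullPair G S A B) (hG : ¬ fourP1.graph ⊴ G) :
    Gᶜ.CliqueFreeOn A 3 := by
  rw [cliqueFreeOn_three_iff]
  simp only [compl_adj]
  rintro x hx y hy z hz ⟨nxy, hxy⟩ ⟨nxz, hxz⟩ ⟨nyz, hyz⟩
  obtain ⟨b, hb⟩ := h.right.nonempty
  refine hG (fourP1_isIndContained ?_ hxy hxz (h.not_adj hx hb) hyz (h.not_adj hy hb)
    (h.not_adj hz hb))
  simp [nxy, nxz, nyz, h.ne hx hb, h.ne hy hb, h.ne hz hb]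

theorem cliqueFreeOn_of_K3addP1_free (h : IsFullPair G S A B) (hG : ¬ K3addP1.graph ⊴ G) :
    G.CliqueFreeOn A 3 := by
  rw [cliqueFreeOn_three_iff]
  intro x hx y hy z hz hxy hxz hyz
  obtain ⟨b, hb⟩ := h.right.nonempty
  exact hG (K3addP1_isIndContained hxy hxz hyz (h.not_adj hx hb) (h.not_adj hy hb)
    (h.not_adj hz hb))

theorem not_adj_of_paw_free (h : IsFullPair G S A B) (hG : ¬ paw.graph ⊴ G) {s x y : V}
    (hs : s ∈ S) (hx : x ∈ A) (hy : y ∈ A) (hsx : G.Adj s x) (hsy : G.Adj s y) :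
    ¬ G.Adj x y := by
  intro hxy
  obtain ⟨b, hb, hsb⟩ := h.right.exists_adj hs
  exact hG (paw_isIndContained hxy hsx.symm hsy.symm hsb (h.not_adj hx hb) (h.not_adj hy hb))

theorem cliqueFreeOn_of_paw_free (h : IsFullPair G S A B) (hG : ¬ paw.graph ⊴ G)
    (hS : S.Nonempty) : G.CliqueFreeOn A 3 := by
  rw [cliqueFreeOn_three_iff]
  intro x hx y hy z hz hxy hxz hyz
  have adj_of_triangle : ∀ u v w t, G.Adj u v → G.Adj u w → G.Adj v w → G.Adj w t →
      ¬ G.Adj u t → G.Adj v t := by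
    intro u v w t huv huw hvw hwt hut
    by_contra hvt
    exact hG (paw_isIndContained huv huw hvw hwt hut hvt)
  let X : Set V := {w | ∃ u ∈ A, ∃ v ∈ A, G.Adj u v ∧ G.Adj u w ∧ G.Adj v w}
  have subset_X : A ⊆ X := by
    by_contra hAX
    obtain ⟨w, ⟨hw, u, hu, v, hv, huv, huw, hvw⟩, t, ⟨-, htX⟩, hwt⟩ :=
      exists_adj_mem_notMem_of_preconnected_induce (X := X) h.left.connected.preconnected
        ⟨z, hz, x, hx, y, hy, hxy, hxz, hyz⟩ (Set.sdiff_nonempty.2 hAX)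
    by_cases hut : G.Adj u t
    · exact htX ⟨u, hu, w, hw, huw, hut, hwt⟩
    · exact htX ⟨v, hv, w, hw, hvw, adj_of_triangle u v w t huv huw hvw hwt hut, hwt⟩
  obtain ⟨s, hs⟩ := hS
  obtain ⟨w, hw, hsw⟩ := h.left.exists_adj hs
  obtain ⟨u, hu, v, hv, huv, huw, hvw⟩ := subset_X hw
  by_cases hus : G.Adj u s
  · exact h.not_adj_of_paw_free hG hs hu hw hus.symm hsw huw
  · exact h.not_adj_of_paw_free hG hs hv hw
      (adj_of_triangle u v w s huv huw hvw hsw.symm hus).symm hsw hvw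

theorem compl_cliqueFreeOn_or_encard_le_one (h : IsFullPair G S A B)
    (hG : ¬ fourP1.graph ⊴ G ∨ ¬ P2add2P1.graph ⊴ G ∨ ¬ P3addP1.graph ⊴ G) :
    Gᶜ.CliqueFreeOn A 3 ∨ B.encard ≤ 1 := by
  obtain hG | hG := hG
  · exact .inl (h.compl_cliqueFreeOn_of_fourP1_free hG)
  · rw [or_iff_not_imp_right, not_le]
    intro hB
    refine CliqueFreeOn.mono _ (Nat.le_succ 2) ((cliqueFreeOn_two _).2 fun x hx y hy hxy hadj => ?_)
    exact hadj.2 (h.isClique_of_P2add2P1_or_P3addP1_free hG hB hx hy hxy)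

theorem cliqueFreeOn_four (h : IsFullPair G S A B) (hS : S.Nonempty)
    (hG : ¬ paw.graph ⊴ G ∨ ¬ K3addP1.graph ⊴ G ∨ ¬ K4.graph ⊴ G) : G.CliqueFreeOn A 4 := by
  obtain hG | hG | hG := hG
  · exact CliqueFreeOn.mono _ (Nat.le_succ 3) (h.cliqueFreeOn_of_paw_free hG hS)
  · exact CliqueFreeOn.mono _ (Nat.le_succ 3) (h.cliqueFreeOn_of_K3addP1_free hG)
  · exact CliqueFree.cliqueFreeOn _ (not_not.1 fun h => hG ⟨topEmbeddingOfNotCliqueFree h⟩)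

theorem isDetermined_of_cliqueFreeOn (h : IsFullPair G S A B)
    (hG : ¬ fourP1.graph ⊴ G ∨ ¬ P2add2P1.graph ⊴ G ∨ ¬ P3addP1.graph ⊴ G)
    (hG' : ¬ paw.graph ⊴ G ∨ ¬ K3addP1.graph ⊴ G ∨ ¬ K4.graph ⊴ G) : IsDetermined G 9 S := by
  obtain rfl | hS := S.eq_empty_or_nonempty
  · exact isDetermined_of_encard_le (by simp)
  obtain hA | hB := h.compl_cliqueFreeOn_or_encard_le_one hG
  · have hlt := encard_lt_choose_of_cliqueFreeOn (h.cliqueFreeOn_four hS hG') hA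
    exact h.left.isDetermined_of_encard_le (Order.le_of_lt_succ hlt)
  · exact h.right.isDetermined_of_encard_le (hB.trans (by norm_num))

end IsFullPair

end Cliques

section FourCycle

variable {V : Type*} {G : SimpleGraph V} {S A B : Set V}

theorem exists_encard_le_two_inter_nonempty (D : Set V) :
    ∃ X ⊆ D, X.encard ≤ 2 ∧ ∀ E : Set V, (D ∩ E).Nonempty → (D \ E).Subsingleton →
      (X ∩ E).Nonempty := by
  obtain hD | ⟨x, hx, y, hy, hxy⟩ := D.subsingleton_or_nontrivial
  · exact ⟨D, subset_rfl, (Set.encard_le_one_iff_subsingleton.2 hD).trans (by norm_num),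
      fun E hE _ => hE⟩
  · refine ⟨{x, y}, Set.pair_subset hx hy, (Set.encard_pair hxy).le, fun E _ hE => ?_⟩
    by_cases hxE : x ∈ E
    · exact ⟨x, .inl rfl, hxE⟩
    · by_cases hyE : y ∈ E
      · exact ⟨y, .inr rfl, hyE⟩
      · exact absurd (hE ⟨hx, hxE⟩ ⟨hy, hyE⟩) hxy

namespace IsFullPair

theorem subsingleton_sdiff_neighborSet (h : IsFullPair G S A B)
    (hG : ¬ P2add2P1.graph ⊴ G ∨ ¬ P3addP1.graph ⊴ G) (hA : G.IsClique A) {s b : V} (hs : s ∈ S)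
    (hb : b ∈ B) (hsb : ¬ G.Adj s b) : (A \ G.neighborSet s).Subsingleton := by
  rintro x ⟨hx, hsx⟩ y ⟨hy, hsy⟩
  by_contra hxy
  have hxs : ¬ G.Adj x s := fun h => hsx h.symm
  have hys : ¬ G.Adj y s := fun h => hsy h.symm
  obtain hG | hG := hG
  · exact hG (P2add2P1_isIndContained (hA hx hy hxy) hxs (h.not_adj hx hb) hys (h.not_adj hy hb)
      hsb (h.right.disjoint.ne_of_mem hs hb))
  · obtain ⟨a, ha, hsa⟩ := h.left.exists_adj hs
    have hax : a ≠ x := by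
      rintro rfl
      exact hsx hsa
    exact hG (P3addP1_isIndContained hsa (hA ha hx hax) hsx hsb (h.not_adj ha hb)
      (h.not_adj hx hb) (h.left.disjoint.ne_of_mem hs hx))

theorem disjoint_neighborSet_of_C4_free (h : IsFullPair G S A B)
    (hG : ¬ P2add2P1.graph ⊴ G ∨ ¬ P3addP1.graph ⊴ G) (hC : ¬ C4.graph ⊴ G) (hA : G.IsClique A)
    {s t : V} (hs : s ∈ S) (ht : t ∈ S) (hsB : ∀ b ∈ B, G.Adj s b) (htB : ∀ b ∈ B, G.Adj t b)
    (hst : ¬ A ∩ G.neighborSet s ⊆ G.neighborSet t)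
    (hts : ¬ A ∩ G.neighborSet t ⊆ G.neighborSet s) :
    A ∩ G.neighborSet t ⊆ A \ G.neighborSet s ∧
      ((A \ G.neighborSet s) \ G.neighborSet t).Subsingleton := by
  obtain ⟨a, ⟨ha, hsa⟩, hta⟩ := Set.not_subset.1 hst
  obtain ⟨a', ⟨ha', hta'⟩, hsa'⟩ := Set.not_subset.1 hts
  obtain ⟨b, hb⟩ := h.right.nonempty
  simp only [mem_neighborSet] at hsa hta hsa' hta'
  have hne : s ≠ t := by
    rintro rfl
    exact hta hsa
  have hadj : ¬ G.Adj s t := by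
    have haa' : a ≠ a' := by
      rintro rfl
      exact hsa' hsa
    intro hst
    exact hC (C4_isIndContained hsa (hA ha ha' haa') hta'.symm hst.symm hsa'
      (fun h => hta h.symm) (h.left.disjoint.ne_of_mem hs ha')
      (h.left.disjoint.ne_of_mem ht ha).symm)
  refine ⟨fun c ⟨hc, htc⟩ => ⟨hc, fun hsc => ?_⟩, ?_⟩
  · exact hC (C4_isIndContained hsc (Adj.symm htc) (htB b hb) (hsB b hb).symm hadj
      (h.not_adj hc hb) hne (h.ne hc hb))
  · rintro x ⟨⟨hx, hsx⟩, htx⟩ y ⟨⟨hy, hsy⟩, hty⟩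
    simp only [mem_neighborSet] at hsx htx hsy hty
    by_contra hxy
    obtain hG | hG := hG
    · exact hG (P2add2P1_isIndContained (hA hx hy hxy) (fun h => hsx h.symm) (fun h => htx h.symm)
        (fun h => hsy h.symm) (fun h => hty h.symm) hadj hne)
    · exact hG (P3addP1_isIndContained (hsB b hb) (htB b hb).symm hadj hsx (h.not_adj' hx hb) htx
        hne)

theorem exists_dominating_of_C4_free [Finite V] (h : IsFullPair G S A B)
    (hG : ¬ P2add2P1.graph ⊴ G ∨ ¬ P3addP1.graph ⊴ G) (hC : ¬ C4.graph ⊴ G)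
    (hA : G.IsClique A) : ∃ X ⊆ A, X.encard ≤ 5 ∧ ∀ s ∈ S, ∃ a ∈ X, G.Adj s a := by
  obtain ⟨X, hXA, hX, hX'⟩ := exists_encard_le_two_inter_nonempty A
  have adj_of_incomplete : ∀ s ∈ S, ¬ (∀ b ∈ B, G.Adj s b) → ∃ a ∈ X, G.Adj s a := by
    intro s hs hsB
    push Not at hsB
    obtain ⟨b, hb, hsb⟩ := hsB
    exact hX' _ (h.left.exists_adj hs) (h.subsingleton_sdiff_neighborSet hG hA hs hb hsb)
  by_cases hT : ∃ s, s ∈ S ∧ ∀ b ∈ B, G.Adj s b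
  swap
  · exact ⟨X, hXA, hX.trans (by norm_num), fun s hs => adj_of_incomplete s hs fun hsB =>
      hT ⟨s, hs, hsB⟩⟩
  obtain ⟨s, ⟨hs, hsB⟩, hmin⟩ :=
    exists_minimalFor_of_wellFoundedLT _ (fun s => A ∩ G.neighborSet s) hT
  obtain ⟨a, ha, hsa⟩ := h.left.exists_adj hs
  obtain ⟨Y, hYD, hY, hY'⟩ := exists_encard_le_two_inter_nonempty (A \ G.neighborSet s)
  refine ⟨insert a (X ∪ Y), Set.insert_subset ha (Set.union_subset hXA fun y hy => (hYD hy).1),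
    ?_, fun t ht => ?_⟩
  · calc (insert a (X ∪ Y)).encard ≤ X.encard + Y.encard + 1 :=
          (Set.encard_insert_le _ _).trans (add_le_add_left (Set.encard_union_le _ _) 1)
      _ ≤ 2 + 2 + 1 := by gcongr
  · by_cases htB : ∀ b ∈ B, G.Adj t b
    swap
    · obtain ⟨c, hc, htc⟩ := adj_of_incomplete t ht htB
      exact ⟨c, .inr (.inl hc), htc⟩
    by_cases hta : G.Adj t a
    · exact ⟨a, .inl rfl, hta⟩
    have hst : ¬ A ∩ G.neighborSet s ⊆ G.neighborSet t := fun hst => hta (hst ⟨ha, hsa⟩)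
    have hts : ¬ A ∩ G.neighborSet t ⊆ G.neighborSet s := fun hts =>
      hst fun c hc => (hmin ⟨ht, htB⟩ (Set.subset_inter Set.inter_subset_left hts) hc).2
    obtain ⟨hsub, hsing⟩ := h.disjoint_neighborSet_of_C4_free hG hC hA hs ht hsB htB hst hts
    obtain ⟨c, hc, htc⟩ := h.left.exists_adj ht
    obtain ⟨y, hy, hty⟩ := hY' (G.neighborSet t) ⟨c, hsub ⟨hc, htc⟩, htc⟩ hsing
    exact ⟨y, .inr (.inr hy), hty⟩

theorem isDetermined_of_C4_free [Finite V] (h : IsFullPair G S A B)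
    (hG : ¬ P2add2P1.graph ⊴ G ∨ ¬ P3addP1.graph ⊴ G) (hC : ¬ C4.graph ⊴ G) :
    IsDetermined G (5 + 5) S := by
  obtain hA | hA := le_or_gt A.encard 1
  · exact h.left.isDetermined_of_encard_le (hA.trans (by norm_num))
  obtain hB | hB := le_or_gt B.encard 1
  · exact h.right.isDetermined_of_encard_le (hB.trans (by norm_num))
  obtain ⟨X, hXA, hX, hSX⟩ := h.exists_dominating_of_C4_free hG hC
    (h.isClique_of_P2add2P1_or_P3addP1_free hG hB)
  obtain ⟨Y, hYB, hY, hSY⟩ := h.symm.exists_dominating_of_C4_free hG hC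
    (h.symm.isClique_of_P2add2P1_or_P3addP1_free hG hA)
  exact h.isDetermined_of_dominating hXA hYB hX hY hSX hSY

end IsFullPair

end FourCycle

section Claw

variable {V : Type*} {G : SimpleGraph V} {S A B : Set V}

theorem encard_le_two_of_forall_ne {Q : Set V}
    (h : ∀ x ∈ Q, ∀ y ∈ Q, ∀ z ∈ Q, x ≠ y → x ≠ z → ¬ y ≠ z) : Q.encard ≤ 2 := by
  by_contra! hQ
  obtain ⟨T, hTQ, hT⟩ := Set.exists_subset_encard_eq (k := 3) (Order.add_one_le_of_lt hQ)
  obtain ⟨x, y, z, hxy, hxz, hyz, rfl⟩ := Set.encard_eq_three.1 hT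
  exact h x (hTQ (by simp)) y (hTQ (by simp)) z (hTQ (by simp)) hxy hxz hyz

theorem two_mul_ncard_le_sum_ncard_neighborSet [Fintype A] (h : (G.induce A).Connected) :
    2 * A.ncard ≤ ∑ a : A, (A ∩ G.neighborSet a).ncard + 2 := by
  classical
  have degree_eq : ∀ a : A, (G.induce A).degree a = (A ∩ G.neighborSet a).ncard := by
    intro a
    have image_eq : Subtype.val '' (G.induce A).neighborSet a = A ∩ G.neighborSet a :=
      Subtype.image_preimage_val A _
    rw [← image_eq, Set.ncard_image_of_injective _ Subtype.val_injective,
      ← card_neighborSet_eq_degree, ← Nat.card_eq_fintype_card, Nat.card_coe_set_eq]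
  have hle := h.card_vert_le_card_edgeSet_add_one
  have hsum := sum_degrees_eq_twice_card_edges (G.induce A)
  rw [Nat.card_coe_set_eq, Nat.card_eq_fintype_card, ← edgeFinset_card] at hle
  simp only [degree_eq] at hsum
  omega

theorem IsFullComponent.ncard_le_sum_ncard_neighborSet [Fintype A] [Finite V]
    (h : IsFullComponent G S A) : S.ncard ≤ ∑ a : A, (S ∩ G.neighborSet a).ncard := by
  have hS : S ⊆ ⋃ a : A, S ∩ G.neighborSet a := by
    intro s hs
    obtain ⟨a, ha, hsa⟩ := h.exists_adj hs
    exact Set.mem_iUnion.2 ⟨⟨a, ha⟩, hs, hsa.symm⟩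
  exact (Set.ncard_le_ncard hS).trans (Set.ncard_iUnion_le_of_fintype _)

theorem IsFullComponent.ncard_add_two_mul_ncard_le [Finite V] (h : IsFullComponent G S A) {d : ℕ}
    (hd : ∀ a ∈ A, (G.neighborSet a).ncard ≤ d) : S.ncard + 2 * A.ncard ≤ d * A.ncard + 2 := by
  have := Fintype.ofFinite A
  have hsplit : ∀ a : A, (S ∩ G.neighborSet a).ncard + (A ∩ G.neighborSet a).ncard ≤ d := by
    intro a
    rw [← Set.ncard_union_eq (h.disjoint.mono Set.inter_subset_left Set.inter_subset_left)]
    exact (Set.ncard_le_ncard (Set.union_subset Set.inter_subset_right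
      Set.inter_subset_right)).trans (hd a a.2)
  calc S.ncard + 2 * A.ncard
      ≤ ∑ a : A, (S ∩ G.neighborSet a).ncard + (∑ a : A, (A ∩ G.neighborSet a).ncard + 2) :=
        add_le_add h.ncard_le_sum_ncard_neighborSet
          (two_mul_ncard_le_sum_ncard_neighborSet h.connected)
    _ = ∑ a : A, ((S ∩ G.neighborSet a).ncard + (A ∩ G.neighborSet a).ncard) + 2 := by
        rw [Finset.sum_add_distrib, add_assoc]
    _ ≤ ∑ _a : A, d + 2 := by
        gcongr with a
        exact hsplit a
    _ = d * A.ncard + 2 := by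
        rw [Finset.sum_const, Finset.card_univ, ← Nat.card_eq_fintype_card, Nat.card_coe_set_eq,
          smul_eq_mul, mul_comm]

theorem IsFullComponent.isDetermined_of_claw_free [Finite V] (h : IsFullComponent G S A)
    (hG : ¬ claw.graph ⊴ G) (hA : ∀ a ∈ A, ∀ x y, G.Adj a x → G.Adj a y → ¬ G.Adj x y) :
    IsDetermined G 2 S := by
  have hdeg : ∀ a ∈ A, (G.neighborSet a).ncard ≤ 2 := by
    intro a ha
    by_contra! hlt
    obtain ⟨x, y, z, hx, hy, hz, hxy, hxz, hyz⟩ := (Set.two_lt_ncard_iff (Set.toFinite _)).1 hlt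
    exact hG (claw_isIndContained hx hy hz (hA a ha x y hx hy) (hA a ha x z hx hz)
      (hA a ha y z hy hz) (by simp [hxy, hxz, hyz]))
  refine MinSep.isDetermined_of_encard_le
    (Set.encard_le_coe_iff_finite_ncard_le.2 ⟨Set.toFinite S, ?_⟩)
  have := h.ncard_add_two_mul_ncard_le hdeg
  omega

namespace IsFullPair

theorem isDetermined_of_claw_paw_free [Finite V] (h : IsFullPair G S A B)
    (hG : ¬ claw.graph ⊴ G) (hG' : ¬ paw.graph ⊴ G) : IsDetermined G 2 S := by
  obtain rfl | hS := S.eq_empty_or_nonempty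
  · exact isDetermined_of_encard_le (by simp)
  obtain hA | hA := A.subsingleton_or_nontrivial
  · exact h.left.isDetermined_of_encard_le
      ((Set.encard_le_one_iff_subsingleton.2 hA).trans (by norm_num))
  refine h.left.isDetermined_of_claw_free hG fun a ha x y hax hay hxy => ?_
  have not_adj_of_mem : ∀ s ∈ S, ∀ c ∈ A, G.Adj a s → G.Adj a c → ¬ G.Adj s c :=
    fun s hs c hc has hac hsc => h.not_adj_of_paw_free hG' hs ha hc has.symm hsc hac
  by_cases hx : x ∈ S <;> by_cases hy : y ∈ S
  · obtain ⟨w, hw, haw⟩ := h.left.exists_adj_of_nontrivial hA ha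
    exact hG' (paw_isIndContained hxy hax.symm hay.symm haw (not_adj_of_mem x hx w hw hax haw)
      (not_adj_of_mem y hy w hw hay haw))
  · exact not_adj_of_mem x hx y (h.left.mem_of_adj ha hay hy) hax hay hxy
  · exact not_adj_of_mem y hy x (h.left.mem_of_adj ha hax hx) hay hax hxy.symm
  · exact cliqueFreeOn_three_iff.1 (h.cliqueFreeOn_of_paw_free hG' hS) a ha
      x (h.left.mem_of_adj ha hax hx) y (h.left.mem_of_adj ha hay hy) hax hay hxy

theorem encard_inter_neighborSet_le_two (h : IsFullPair G S A B) (hG : ¬ claw.graph ⊴ G)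
    (hA : G.CliqueFreeOn A 3) {v : V} (hv : v ∈ A ∪ S) :
    (A ∩ G.neighborSet v).encard ≤ 2 := by
  rw [cliqueFreeOn_three_iff] at hA
  refine encard_le_two_of_forall_ne ?_
  rintro x ⟨hx, hvx⟩ y ⟨hy, hvy⟩ z ⟨hz, hvz⟩ hxy hxz hyz
  obtain hv | hv := hv
  · exact hG (claw_isIndContained hvx hvy hvz (hA v hv x hx y hy hvx hvy)
      (hA v hv x hx z hz hvx hvz) (hA v hv y hy z hz hvy hvz) (by simp [hxy, hxz, hyz]))
  · obtain ⟨b, hb, hvb⟩ := h.right.exists_adj hv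
    have adj_of_adj : ∀ x ∈ A, ∀ y ∈ A, G.Adj v x → G.Adj v y → x ≠ y → G.Adj x y := by
      intro x hx y hy hvx hvy hxy
      by_contra hadj
      exact hG (claw_isIndContained hvx hvy hvb hadj (h.not_adj hx hb) (h.not_adj hy hb)
        (by simp [hxy, h.ne hx hb, h.ne hy hb]))
    exact hA x hx y hy z hz (adj_of_adj x hx y hy hvx hvy hxy)
      (adj_of_adj x hx z hz hvx hvz hxz) (adj_of_adj y hy z hz hvy hvz hyz)

theorem isDetermined_of_claw_K3addP1_free [Finite V] (h : IsFullPair G S A B)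
    (hG : ¬ claw.graph ⊴ G) (hG' : ¬ K3addP1.graph ⊴ G) : IsDetermined G 6 S := by
  obtain hA | hA := le_or_gt A.encard 6
  · exact h.left.isDetermined_of_encard_le hA
  refine (h.left.isDetermined_of_claw_free hG fun a ha x y hax hay hxy => ?_).mono (by norm_num)
  have mem_of_adj : ∀ v, G.Adj a v → v ∈ A ∪ S := fun v hav =>
    or_iff_not_imp_right.2 (h.left.mem_of_adj ha hav)
  have degree_le : ∀ v ∈ A ∪ S, (A ∩ G.neighborSet v).encard ≤ 2 := fun v =>
    h.encard_inter_neighborSet_le_two hG (h.cliqueFreeOn_of_K3addP1_free hG')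
  have encard_le : ((A ∩ G.neighborSet a) ∪ (A ∩ G.neighborSet x) ∪
      (A ∩ G.neighborSet y)).encard ≤ 6 :=
    calc _ ≤ (A ∩ G.neighborSet a).encard + (A ∩ G.neighborSet x).encard +
          (A ∩ G.neighborSet y).encard := (Set.encard_union_le _ _).trans <|
            add_le_add_left (Set.encard_union_le _ _) _
      _ ≤ 2 + 2 + 2 := by
        gcongr
        exacts [degree_le a (.inl ha), degree_le x (mem_of_adj x hax),
          degree_le y (mem_of_adj y hay)]
      _ = 6 := by norm_num
  obtain ⟨d, hd, hd'⟩ := Set.not_subset.1 fun hsub =>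
    hA.not_ge ((Set.encard_le_encard hsub).trans encard_le)
  simp only [Set.mem_union, Set.mem_inter_iff, hd, true_and, mem_neighborSet, not_or] at hd'
  exact hG' (K3addP1_isIndContained hax hay hxy hd'.1.1 hd'.1.2 hd'.2)

end IsFullPair

end Claw

section Diamond

variable {V : Type*} {G : SimpleGraph V} {S A B : Set V}

namespace IsFullPair

theorem isClique_or_isClique_of_fourP1_free (h : IsFullPair G S A B) (hG : ¬ fourP1.graph ⊴ G) :
    G.IsClique A ∨ G.IsClique B := by
  by_contra! hAB
  simp only [isClique_iff, Set.Pairwise] at hAB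
  push Not at hAB
  obtain ⟨⟨a, ha, a', ha', naa', haa'⟩, b, hb, b', hb', nbb', hbb'⟩ := hAB
  refine hG (fourP1_isIndContained ?_ haa' (h.not_adj ha hb) (h.not_adj ha hb')
    (h.not_adj ha' hb) (h.not_adj ha' hb') hbb')
  simp [naa', nbb', h.ne ha hb, h.ne ha hb', h.ne ha' hb, h.ne ha' hb']

theorem inter_neighborSet_subsingleton_of_diamond_free (h : IsFullPair G S A B)
    (hG : ¬ diamond.graph ⊴ G) (hA : G.IsClique A) {s : V} (hs : s ∈ S)
    (hsA : ¬ ∀ a ∈ A, G.Adj s a) : (A ∩ G.neighborSet s).Subsingleton := by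
  rintro x ⟨hx, hsx⟩ y ⟨hy, hsy⟩
  by_contra hxy
  push Not at hsA
  obtain ⟨a, ha, hsa⟩ := hsA
  have hax : a ≠ x := by
    rintro rfl
    exact hsa hsx
  have hay : a ≠ y := by
    rintro rfl
    exact hsa hsy
  exact hG (diamond_isIndContained hsa hsx hsy (hA ha hx hax) (hA ha hy hay) (hA hx hy hxy)
    (h.left.disjoint.ne_of_mem hs ha))

theorem not_adj_of_C4_diamond_free (h : IsFullPair G S A B) (hC : ¬ C4.graph ⊴ G)
    (hD : ¬ diamond.graph ⊴ G) (hA : G.IsClique A) (hA' : A.Nontrivial) {s t b c : V}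
    (hs : s ∈ S) (ht : t ∈ S) (hst : s ≠ t) (hsA : ∀ a ∈ A, G.Adj s a) (htA : ∀ a ∈ A, G.Adj t a)
    (hb : b ∈ B) (hc : c ∈ B) (hsb : G.Adj s b) (htc : G.Adj t c) : b ≠ c ∧ ¬ G.Adj b c := by
  obtain ⟨p, hp, q, hq, hpq⟩ := hA'
  have adj : G.Adj s t := by
    by_contra hadj
    exact hD (diamond_isIndContained hadj (hsA p hp) (hsA q hq) (htA p hp) (htA q hq)
      (hA hp hq hpq) hst)
  have not_adj_of_adj : ∀ b ∈ B, G.Adj s b → ¬ G.Adj t b := fun b hb hsb htb =>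
    hD (diamond_isIndContained (h.not_adj hp hb) (hsA p hp).symm (htA p hp).symm hsb.symm
      htb.symm adj (h.ne hp hb))
  refine ⟨?_, fun hbc => ?_⟩
  · rintro rfl
    exact not_adj_of_adj b hb hsb htc
  · exact hC (C4_isIndContained hsb hbc htc.symm adj.symm (fun hsc => not_adj_of_adj c hc hsc htc)
      (fun hbt => not_adj_of_adj b hb hsb hbt.symm) (h.right.disjoint.ne_of_mem hs hc)
      (h.right.disjoint.ne_of_mem ht hb).symm)

theorem encard_setOf_forall_adj_le_two (h : IsFullPair G S A B) (hG : ¬ fourP1.graph ⊴ G)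
    (hC : ¬ C4.graph ⊴ G) (hD : ¬ diamond.graph ⊴ G) (hA : G.IsClique A) (hA' : A.Nontrivial) :
    {s ∈ S | ∀ a ∈ A, G.Adj s a}.encard ≤ 2 := by
  refine encard_le_two_of_forall_ne ?_
  rintro s ⟨hs, hsA⟩ t ⟨ht, htA⟩ u ⟨hu, huA⟩ hst hsu htu
  obtain ⟨b, hb, hsb⟩ := h.right.exists_adj hs
  obtain ⟨c, hc, htc⟩ := h.right.exists_adj ht
  obtain ⟨d, hd, hud⟩ := h.right.exists_adj hu
  exact cliqueFreeOn_three_iff.1 (h.symm.compl_cliqueFreeOn_of_fourP1_free hG) b hb c hc d hd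
    (h.not_adj_of_C4_diamond_free hC hD hA hA' hs ht hst hsA htA hb hc hsb htc)
    (h.not_adj_of_C4_diamond_free hC hD hA hA' hs hu hsu hsA huA hb hd hsb hud)
    (h.not_adj_of_C4_diamond_free hC hD hA hA' ht hu htu htA huA hc hd htc hud)

theorem not_adj_of_inter_neighborSet_eq_singleton (h : IsFullPair G S A B) (hC : ¬ C4.graph ⊴ G)
    (hA : G.IsClique A) {s t a b : V} (hs : s ∈ S) (ht : t ∈ S) (hab : a ≠ b)
    (hsa : A ∩ G.neighborSet s = {a}) (htb : A ∩ G.neighborSet t = {b}) :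
    s ≠ t ∧ ¬ G.Adj s t := by
  obtain ⟨ha, hsa'⟩ : a ∈ A ∩ G.neighborSet s := hsa ▸ rfl
  obtain ⟨hb, htb'⟩ : b ∈ A ∩ G.neighborSet t := htb ▸ rfl
  refine ⟨?_, fun hst => ?_⟩
  · rintro rfl
    exact hab (Set.singleton_injective (hsa.symm.trans htb))
  · have hsb : ¬ G.Adj s b := fun hsb => hab.symm (hsa.subset ⟨hb, hsb⟩)
    have hta : ¬ G.Adj a t := fun hat => hab (htb.subset ⟨ha, hat.symm⟩)
    exact hC (C4_isIndContained hsa' (hA ha hb hab) (Adj.symm htb') hst.symm hsb hta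
      (h.left.disjoint.ne_of_mem hs hb) (h.left.disjoint.ne_of_mem ht ha).symm)

theorem encard_setOf_inter_neighborSet_eq_singleton_le_two (h : IsFullPair G S A B)
    (hG : ¬ fourP1.graph ⊴ G) (hC : ¬ C4.graph ⊴ G) (hA : G.IsClique A) (hA' : 3 < A.encard) :
    {a | ∃ s ∈ S, A ∩ G.neighborSet s = {a}}.encard ≤ 2 := by
  refine encard_le_two_of_forall_ne ?_
  rintro a ⟨s, hs, hsa⟩ b ⟨t, ht, htb⟩ c ⟨u, hu, huc⟩ hab hac hbc
  obtain ⟨d, hd, hdabc⟩ := Set.not_subset.1 fun hsub : A ⊆ {a, b, c} =>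
    hA'.not_ge <| (Set.encard_le_encard hsub).trans
      (Set.encard_eq_three.2 ⟨a, b, c, hab, hac, hbc, rfl⟩).le
  simp only [Set.mem_insert_iff, Set.mem_singleton_iff, not_or] at hdabc
  obtain ⟨hda, hdb, hdc⟩ := hdabc
  have hsd : ¬ G.Adj s d := fun hsd => hda (hsa.subset ⟨hd, hsd⟩)
  have htd : ¬ G.Adj t d := fun htd => hdb (htb.subset ⟨hd, htd⟩)
  have hud : ¬ G.Adj u d := fun hud => hdc (huc.subset ⟨hd, hud⟩)
  obtain ⟨nst, hst⟩ := h.not_adj_of_inter_neighborSet_eq_singleton hC hA hs ht hab hsa htb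
  obtain ⟨nsu, hsu⟩ := h.not_adj_of_inter_neighborSet_eq_singleton hC hA hs hu hac hsa huc
  obtain ⟨ntu, htu⟩ := h.not_adj_of_inter_neighborSet_eq_singleton hC hA ht hu hbc htb huc
  have ne_d : ∀ {s}, s ∈ S → s ≠ d := fun hs => h.left.disjoint.ne_of_mem hs hd
  refine hG (fourP1_isIndContained ?_ hst hsu hsd htu htd hud)
  simp [nst, nsu, ntu, ne_d hs, ne_d ht, ne_d hu]

theorem isDetermined_of_isClique_of_fourP1_C4_diamond_free (h : IsFullPair G S A B)
    (hG : ¬ fourP1.graph ⊴ G) (hC : ¬ C4.graph ⊴ G) (hD : ¬ diamond.graph ⊴ G)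
    (hA : G.IsClique A) : IsDetermined G 6 S := by
  obtain hA' | hA' := le_or_gt A.encard 3
  · exact h.left.isDetermined_of_encard_le (hA'.trans (by norm_num))
  have nontrivial : A.Nontrivial := Set.one_lt_encard_iff_nontrivial.1 (lt_trans (by norm_num) hA')
  obtain ⟨p, hp, q, hq, hpq⟩ := id nontrivial
  let Q : Set V := {s ∈ S | ∀ a ∈ A, G.Adj s a}
  let T : Set V := {a | ∃ s ∈ S, A ∩ G.neighborSet s = {a}}
  refine ⟨Q ∪ T ∪ {p, q}, ?_, fun v w hvw hv => ?_⟩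
  · calc (Q ∪ T ∪ {p, q}).encard ≤ Q.encard + T.encard + ({p, q} : Set V).encard :=
          (Set.encard_union_le _ _).trans (add_le_add_left (Set.encard_union_le _ _) _)
      _ ≤ 2 + 2 + 2 := by
          gcongr
          exacts [h.encard_setOf_forall_adj_le_two hG hC hD hA nontrivial,
            h.encard_setOf_inter_neighborSet_eq_singleton_le_two hG hC hA hA',
            (Set.encard_pair hpq).le]
      _ = (6 : ℕ) := by norm_num
  by_cases hvA : ∀ a ∈ A, G.Adj v a
  · exact (hvw v (.inl (.inl ⟨hv, hvA⟩))).2.1 rfl ▸ hv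
  have hsub := h.inter_neighborSet_subsingleton_of_diamond_free hD hA hv hvA
  obtain ⟨a, ha, hva⟩ := h.left.exists_adj hv
  have haT : a ∈ T := ⟨v, hv, hsub.eq_singleton_of_mem ⟨ha, hva⟩⟩
  have hwa : G.Adj w a := (hvw a (.inl (.inr haT))).1.1 hva
  by_contra hw
  have hwA : w ∈ A := h.left.mem_of_adj ha hwa.symm hw
  have adj_of_mem : ∀ x ∈ ({p, q} : Set V), x ∈ A → G.Adj v x := by
    intro x hx hxA
    obtain ⟨hadj, heq⟩ := hvw x (.inr hx)
    exact hadj.2 (hA hwA hxA fun hwx => h.left.disjoint.ne_of_mem hv hxA (heq.2 hwx))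
  exact hpq (hsub ⟨hp, adj_of_mem p (.inl rfl) hp⟩ ⟨hq, adj_of_mem q (.inr rfl) hq⟩)

theorem isDetermined_of_fourP1_C4_diamond_free (h : IsFullPair G S A B)
    (hG : ¬ fourP1.graph ⊴ G) (hC : ¬ C4.graph ⊴ G) (hD : ¬ diamond.graph ⊴ G) :
    IsDetermined G 6 S :=
  (h.isClique_or_isClique_of_fourP1_free hG).elim
    (h.isDetermined_of_isClique_of_fourP1_C4_diamond_free hG hC hD)
    (h.symm.isDetermined_of_isClique_of_fourP1_C4_diamond_free hG hC hD)

end IsFullPair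

end Diamond

section Listed

theorem Tame.mono {𝒢 ℋ : Set FinGraph} (h : Tame ℋ) (hGH : 𝒢 ⊆ ℋ) : Tame 𝒢 :=
  h.imp fun _ hp G hG => hp G (hGH hG)

theorem IsListed.isDetermined {ℱ : Set FinGraph} (h : IsListed ℱ) {G : FinGraph}
    (hG : G ∈ freeClass ℱ) {S A B : Set G.V} (hAB : IsFullPair G.graph S A B) :
    IsDetermined G.graph 10 S := by
  have or_of_mem : ∀ F ∈ ({fourP1, P2add2P1, P3addP1, claw} : Set FinGraph),
      ¬ F.graph ⊴ G.graph → (¬ fourP1.graph ⊴ G.graph ∨ ¬ P2add2P1.graph ⊴ G.graph ∨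
        ¬ P3addP1.graph ⊴ G.graph) ∨ ¬ claw.graph ⊴ G.graph := by
    rintro F (rfl | rfl | rfl | rfl) hF <;> simp [hF]
  obtain (rfl | rfl) | ⟨F, hF, rfl⟩ | ⟨F, hF, rfl⟩ | ⟨F, hF, rfl⟩ | ⟨F, hF, rfl⟩ | rfl := h
  all_goals
    simp only [freeClass, Set.mem_ofPred_eq, Set.forall_mem_insert, Set.mem_singleton_iff,
      forall_eq] at hG
  · exact (hAB.isDetermined_of_P4_free hG).mono (by norm_num)
  · obtain hA | hB := hAB.encard_le_one_of_twoP2_free hG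
    · exact hAB.left.isDetermined_of_encard_le (hA.trans (by norm_num))
    · exact hAB.right.isDetermined_of_encard_le (hB.trans (by norm_num))
  · obtain hF | hF := or_of_mem F hF hG.1
    · exact (hAB.isDetermined_of_cliqueFreeOn hF (.inl hG.2)).mono (by norm_num)
    · exact (hAB.isDetermined_of_claw_paw_free hF hG.2).mono (by norm_num)
  · obtain hF | hF := or_of_mem F hF hG.1
    · exact (hAB.isDetermined_of_cliqueFreeOn hF (.inr (.inl hG.2))).mono (by norm_num)
    · exact (hAB.isDetermined_of_claw_K3addP1_free hF hG.2).mono (by norm_num)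
  · refine (hAB.isDetermined_of_cliqueFreeOn ?_ (.inr (.inr hG.2))).mono (by norm_num)
    obtain rfl | rfl | rfl := hF <;> simp [hG.1]
  · refine hAB.isDetermined_of_C4_free ?_ hG.2
    obtain rfl | rfl := hF <;> simp [hG.1]
  · exact (hAB.isDetermined_of_fourP1_C4_diamond_free hG.1 hG.2.1 hG.2.2).mono (by norm_num)

theorem IsListed.tame {ℱ : Set FinGraph} (h : IsListed ℱ) : Tame (freeClass ℱ) :=
  tame_of_isDetermined 10 fun _ hG _ _ _ => h.isDetermined hG

end Listed

section Doubled

variable {U : Type*} {H : SimpleGraph U} {M T : Set U}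

/-- Two disjoint copies of `H`, with the two copies of each vertex in `M` joined by an edge. The
three sequences of graphs with exponentially many minimal separators are of this form. -/
def doubled (H : SimpleGraph U) (M : Set U) : SimpleGraph (U × Bool) where
  Adj x y := (x.2 = y.2 ∧ H.Adj x.1 y.1) ∨ (x.2 ≠ y.2 ∧ x.1 = y.1 ∧ x.1 ∈ M)
  symm := ⟨by
    rintro x y (⟨h, hxy⟩ | ⟨h, hxy, hx⟩)
    · exact .inl ⟨h.symm, hxy.symm⟩
    · exact .inr ⟨h.symm, hxy.symm, hxy ▸ hx⟩⟩
  loopless := ⟨by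
    rintro x (⟨-, h⟩ | ⟨h, -⟩)
    · exact h.ne rfl
    · exact h rfl⟩

/-- One endpoint of each edge joining the two copies of `H` in `doubled H M`: the one in the copy
`true` for the vertices in `T`, the other one for the remaining vertices of `M`. -/
def transversal (M T : Set U) : Set (U × Bool) :=
  {x | x.1 ∈ M ∧ (x.2 = true ↔ x.1 ∈ T)}

theorem mem_transversal {x : U × Bool} :
    x ∈ transversal M T ↔ x.1 ∈ M ∧ (x.2 = true ↔ x.1 ∈ T) := Iff.rfl

theorem transversal_injOn : Set.InjOn (transversal M) {T | T ⊆ M} := by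
  have mem_iff {T : Set U} (hT : T ⊆ M) (u : U) : u ∈ T ↔ (u, true) ∈ transversal M T := by
    simpa [mem_transversal] using @hT u
  intro T hT T' hT' h
  ext u
  rw [mem_iff hT, mem_iff hT', h]

theorem isFullComponent_doubled (hH : (H.induce Mᶜ).Connected)
    (hM : ∀ m ∈ M, ∃ u ∉ M, H.Adj u m) (T : Set U) (b : Bool) :
    IsFullComponent (doubled H M) (transversal M T) ({x | x.2 = b} \ transversal M T) := by
  have mem_copy {u : U} (hu : u ∉ M) : (u, b) ∈ {x | x.2 = b} \ transversal M T :=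
    ⟨rfl, fun h => hu h.1⟩
  refine ⟨Set.disjoint_sdiff_right, ?_, ?_, ?_⟩
  · let copy : H.induce Mᶜ →g (doubled H M).induce ({x | x.2 = b} \ transversal M T) :=
      ⟨fun u => ⟨(u, b), mem_copy u.2⟩, fun h => .inl ⟨rfl, h⟩⟩
    obtain ⟨e⟩ := hH.nonempty
    refine (connected_iff_exists_forall_reachable _).2 ⟨copy e, ?_⟩
    rintro ⟨⟨u, _⟩, rfl, hu⟩
    by_cases huM : u ∈ M
    · obtain ⟨v, hv, hvu⟩ := hM u huM
      exact ((hH.preconnected e ⟨v, hv⟩).map copy).trans (Adj.reachable (.inl ⟨rfl, hvu⟩))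
    · exact (hH.preconnected e ⟨u, huM⟩).map copy
  · rintro ⟨u, _⟩ ⟨rfl, hu⟩ ⟨v, c⟩ (⟨h, -⟩ | ⟨h, huv, huM⟩) hv
    · exact ⟨h.symm, hv⟩
    · simp only [mem_transversal] at hu hv h huv huM
      grind
  · rintro ⟨m, c⟩ ⟨hm, hmT⟩
    by_cases hcb : c = b
    · obtain ⟨u, hu, hum⟩ := hM m hm
      exact ⟨(u, b), mem_copy hu, .inl ⟨hcb, hum.symm⟩⟩
    · refine ⟨(m, b), ⟨rfl, fun h => hcb ?_⟩, .inr ⟨hcb, rfl, hm⟩⟩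
      exact Bool.eq_iff_iff.2 (hmT.trans h.2.symm)

theorem isMinimalSeparator_transversal (hH : (H.induce Mᶜ).Connected)
    (hM : ∀ m ∈ M, ∃ u ∉ M, H.Adj u m) (T : Set U) :
    IsMinimalSeparator (doubled H M) (transversal M T) := by
  refine IsFullPair.isMinimalSeparator ⟨isFullComponent_doubled hH hM T false,
    isFullComponent_doubled hH hM T true, Set.disjoint_left.2 ?_⟩
  rintro x ⟨hx, -⟩ ⟨hx', -⟩
  exact Bool.false_ne_true (hx.symm.trans hx')

theorem two_pow_ncard_le_ncard_isMinimalSeparator_doubled [Finite U]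
    (hH : (H.induce Mᶜ).Connected) (hM : ∀ m ∈ M, ∃ u ∉ M, H.Adj u m) :
    2 ^ M.ncard ≤ {S | IsMinimalSeparator (doubled H M) S}.ncard := by
  rw [← Set.ncard_powerset]
  exact Set.ncard_le_ncard_of_injOn (transversal M)
    (fun T _ => isMinimalSeparator_transversal hH hM T) transversal_injOn

end Doubled

section Exponential

open Filter Polynomial in
theorem not_tame_of_exponential {𝒢 : Set FinGraph} (c d : ℕ) (G : ℕ → FinGraph)
    (hG : ∀ k, G k ∈ 𝒢) (hcard : ∀ k, Nat.card (G k).V = c * k + d)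
    (hsep : ∀ k, 2 ^ k ≤ numMinSep (G k)) : ¬ Tame 𝒢 := by
  rintro ⟨p, hp⟩
  let q : ℝ[X] := p.comp (C (c : ℝ) * X + C (d : ℝ))
  have two_pow_le (k : ℕ) : (2 : ℝ) ^ k ≤ q.eval (k : ℝ) :=
    calc (2 : ℝ) ^ k ≤ numMinSep (G k) := by exact_mod_cast hsep k
      _ ≤ p.eval (Nat.card (G k).V : ℝ) := hp _ (hG k)
      _ = q.eval (k : ℝ) := by simp [q, hcard]
  have isBigO_pow : (fun x : ℝ => q.eval x) =O[atTop] fun x => x ^ q.natDegree := by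
    simpa using isBigO_atTop_of_degree_le q (X ^ q.natDegree) (by simp [degree_le_natDegree])
  have isLittleO_two_pow : (fun k : ℕ => q.eval (k : ℝ)) =o[atTop] fun k => (2 : ℝ) ^ k :=
    (isBigO_pow.comp_tendsto tendsto_natCast_atTop_atTop).trans_isLittleO
      (isLittleO_pow_const_const_pow_of_one_lt _ one_lt_two)
  obtain ⟨k, hk⟩ := (isLittleO_two_pow.def (c := 1 / 2) (by norm_num)).exists
  have hq := two_pow_le k
  have pos : (0 : ℝ) < 2 ^ k := by positivity
  rw [Real.norm_of_nonneg (pos.le.trans hq), Real.norm_of_nonneg pos.le] at hk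
  linarith

end Exponential

section Theta

variable {W : Type*} {H : SimpleGraph W} {k : ℕ}

/-- The star on `Fin (k + 1)` with centre `0`. -/
def starGraph (k : ℕ) : SimpleGraph (Fin (k + 1)) where
  Adj x y := x ≠ y ∧ (x = 0 ∨ y = 0)
  symm := ⟨fun _ _ h => ⟨h.1.symm, h.2.symm⟩⟩
  loopless := ⟨fun _ h => h.1 rfl⟩

/-- Two vertices joined by `k` internally disjoint paths of length three. -/
def theta (k : ℕ) : SimpleGraph (Fin (k + 1) × Bool) :=
  doubled (starGraph k) {0}ᶜ

theorem theta_adj {x y : Fin (k + 1) × Bool} : (theta k).Adj x y ↔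
    (x.2 = y.2 ∧ x.1 ≠ y.1 ∧ (x.1 = 0 ∨ y.1 = 0)) ∨ (x.2 = !y.2 ∧ x.1 = y.1 ∧ x.1 ≠ 0) := by
  rw [Bool.eq_not]
  rfl

theorem connected_induce_compl_compl_singleton {U : Type*} (G : SimpleGraph U) (u : U) :
    (G.induce ({u}ᶜᶜ : Set U)).Connected := by
  rw [compl_compl]
  exact .of_subsingleton

theorem two_pow_le_ncard_isMinimalSeparator_theta (k : ℕ) :
    2 ^ k ≤ {S | IsMinimalSeparator (theta k) S}.ncard := by
  have h := two_pow_ncard_le_ncard_isMinimalSeparator_doubled (H := starGraph k)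
    (connected_induce_compl_compl_singleton _ 0) fun m hm => ⟨0, by simp, Ne.symm hm, .inl rfl⟩
  rwa [Set.ncard_compl, Set.ncard_singleton, Nat.card_fin] at h

theorem not_isIndContained_theta_of_triangle
    (hH : ∃ x y z, H.Adj x y ∧ H.Adj x z ∧ H.Adj y z) : ¬ H ⊴ theta k := by
  rintro ⟨f⟩
  obtain ⟨x, y, z, hxy, hxz, hyz⟩ := hH
  rw [← f.map_adj_iff, theta_adj] at hxy hxz hyz
  grind

theorem not_isIndContained_theta_of_fourCycle
    (hH : ∃ a b c d, H.Adj a b ∧ H.Adj b c ∧ H.Adj c d ∧ H.Adj d a ∧ a ≠ c ∧ b ≠ d) :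
    ¬ H ⊴ theta k := by
  rintro ⟨f⟩
  obtain ⟨a, b, c, d, hab, hbc, hcd, hda, hac, hbd⟩ := hH
  rw [← f.map_adj_iff, theta_adj] at hab hbc hcd hda
  rw [← f.injective.ne_iff] at hac hbd
  grind [Prod.ext_iff]

theorem mem_of_isIndContained_theta {X : FinGraph} (hX : X ∈ fourVertexGraphs)
    (h : X.graph ⊴ theta k) :
    X ∈ ({P4, twoP2, fourP1, P2add2P1, P3addP1, claw} : Set FinGraph) := by
  have not_K3addP1 : ¬ K3addP1.graph ⊴ theta k := not_isIndContained_theta_of_triangle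
    ⟨.inl 0, .inl 1, .inl 2, by simp [K3addP1]⟩
  have not_paw : ¬ paw.graph ⊴ theta k :=
    not_isIndContained_theta_of_triangle (by unfold paw; decide)
  have not_diamond : ¬ diamond.graph ⊴ theta k :=
    not_isIndContained_theta_of_triangle (by unfold diamond; decide)
  have not_K4 : ¬ K4.graph ⊴ theta k :=
    not_isIndContained_theta_of_triangle (by unfold K4; decide)
  have not_C4 : ¬ C4.graph ⊴ theta k :=
    not_isIndContained_theta_of_fourCycle (by unfold C4; decide)
  rcases hX with rfl | rfl | rfl | rfl | rfl | rfl | rfl | rfl | rfl | rfl | rfl <;>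
    first | contradiction | simp

end Theta

section Prism

variable {W : Type*} {H : SimpleGraph W} {k : ℕ}

/-- Two complete graphs on `k + 1` vertices joined by a matching of size `k`. -/
def prism (k : ℕ) : SimpleGraph (Fin (k + 1) × Bool) :=
  doubled ⊤ {0}ᶜ

theorem prism_adj {x y : Fin (k + 1) × Bool} : (prism k).Adj x y ↔
    (x.2 = y.2 ∧ x.1 ≠ y.1) ∨ (x.2 = !y.2 ∧ x.1 = y.1 ∧ x.1 ≠ 0) := by
  rw [Bool.eq_not]
  rfl

theorem two_pow_le_ncard_isMinimalSeparator_prism (k : ℕ) :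
    2 ^ k ≤ {S | IsMinimalSeparator (prism k) S}.ncard := by
  have h := two_pow_ncard_le_ncard_isMinimalSeparator_doubled (H := (⊤ : SimpleGraph (Fin (k + 1))))
    (connected_induce_compl_compl_singleton _ 0) fun m hm => ⟨0, by simp, Ne.symm hm⟩
  rwa [Set.ncard_compl, Set.ncard_singleton, Nat.card_fin] at h

theorem not_isIndContained_prism_of_independent
    (hH : ∃ x y z, ¬ H.Adj x y ∧ ¬ H.Adj x z ∧ ¬ H.Adj y z ∧ x ≠ y ∧ x ≠ z ∧ y ≠ z) :
    ¬ H ⊴ prism k := by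
  rintro ⟨f⟩
  obtain ⟨x, y, z, hxy, hxz, hyz, hne, hne', hne''⟩ := hH
  rw [← f.map_adj_iff, prism_adj] at hxy hxz hyz
  rw [← f.injective.ne_iff] at hne hne' hne''
  have same_copy : (f x).2 = (f y).2 ∨ (f x).2 = (f z).2 ∨ (f y).2 = (f z).2 := by
    cases (f x).2 <;> cases (f y).2 <;> simp
  grind [Prod.ext_iff]

theorem not_isIndContained_prism_of_diamond
    (hH : ∃ a b c d, H.Adj a c ∧ H.Adj a d ∧ H.Adj b c ∧ H.Adj b d ∧ H.Adj c d ∧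
      ¬ H.Adj a b ∧ a ≠ b) : ¬ H ⊴ prism k := by
  rintro ⟨f⟩
  obtain ⟨a, b, c, d, hac, had, hbc, hbd, hcd, hab, hne⟩ := hH
  rw [← f.map_adj_iff, prism_adj] at hac had hbc hbd hcd hab
  rw [← f.injective.ne_iff] at hne
  grind [Prod.ext_iff]

theorem mem_of_isIndContained_prism {X : FinGraph} (hX : X ∈ fourVertexGraphs)
    (h : X.graph ⊴ prism k) : X ∈ ({P4, twoP2, K3addP1, paw, C4, K4} : Set FinGraph) := by
  have not_fourP1 : ¬ fourP1.graph ⊴ prism k :=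
    not_isIndContained_prism_of_independent (by unfold fourP1; decide)
  have not_P2add2P1 : ¬ P2add2P1.graph ⊴ prism k := not_isIndContained_prism_of_independent
    ⟨.inl 0, .inr 0, .inr 1, by simp [P2add2P1]⟩
  have not_P3addP1 : ¬ P3addP1.graph ⊴ prism k := not_isIndContained_prism_of_independent
    ⟨.inl 0, .inl 2, .inr 0, by simp [P3addP1, pathGraph_adj]⟩
  have not_claw : ¬ claw.graph ⊴ prism k := not_isIndContained_prism_of_independent
    ⟨.inr 0, .inr 1, .inr 2, by simp [claw]⟩
  have not_diamond : ¬ diamond.graph ⊴ prism k :=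
    not_isIndContained_prism_of_diamond (by unfold diamond; decide)
  rcases hX with rfl | rfl | rfl | rfl | rfl | rfl | rfl | rfl | rfl | rfl | rfl <;>
    first | contradiction | simp

end Prism

section LadderLineGraph

variable {W : Type*} {H : SimpleGraph W} {k : ℕ}

/-- The path `0, 2, 4, …, 2k` together with a common neighbour `2i + 1` of `2i` and `2i + 2` for
each `i < k`. -/
def triangleChain (k : ℕ) : SimpleGraph (Fin (2 * k + 1)) where
  Adj x y := (x.1 + 1 = y.1 ∨ y.1 + 1 = x.1) ∨
    (x.1 % 2 = 0 ∧ (x.1 + 2 = y.1 ∨ y.1 + 2 = x.1))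
  symm := ⟨by omega⟩
  loopless := ⟨by omega⟩

/-- The line graph of a ladder with `k` subdivided rungs. -/
def ladderLineGraph (k : ℕ) : SimpleGraph (Fin (2 * k + 1) × Bool) :=
  doubled (triangleChain k) {x | x.1 % 2 = 1}

theorem ladderLineGraph_adj {x y : Fin (2 * k + 1) × Bool} : (ladderLineGraph k).Adj x y ↔
    (x.2 = y.2 ∧ ((x.1.1 + 1 = y.1.1 ∨ y.1.1 + 1 = x.1.1) ∨
      (x.1.1 % 2 = 0 ∧ (x.1.1 + 2 = y.1.1 ∨ y.1.1 + 2 = x.1.1)))) ∨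
    (x.2 = !y.2 ∧ x.1.1 = y.1.1 ∧ x.1.1 % 2 = 1) := by
  rw [Bool.eq_not, Fin.val_inj]
  rfl

theorem le_ncard_setOf_odd (k : ℕ) : k ≤ {x : Fin (2 * k + 1) | x.1 % 2 = 1}.ncard := by
  let rung (i : Fin k) : Fin (2 * k + 1) := ⟨2 * i + 1, by omega⟩
  have rung_injective : rung.Injective := fun i j hij => by grind
  calc k = (Set.range rung).ncard := by
        rw [← Nat.card_coe_set_eq, Nat.card_range_of_injective rung_injective, Nat.card_fin]
    _ ≤ _ := Set.ncard_le_ncard (by rintro - ⟨i, rfl⟩; simp [rung])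

theorem connected_induce_triangleChain (k : ℕ) :
    ((triangleChain k).induce {x | x.1 % 2 = 1}ᶜ).Connected := by
  refine (connected_iff_exists_forall_reachable _).2 ⟨⟨0, by simp⟩, ?_⟩
  suffices reachable : ∀ i (hi : 2 * i < 2 * k + 1),
      ((triangleChain k).induce {x | x.1 % 2 = 1}ᶜ).Reachable ⟨0, by simp⟩
        ⟨⟨2 * i, hi⟩, by simp⟩ by
    rintro ⟨⟨x, hx⟩, hx'⟩
    obtain ⟨i, rfl⟩ : Even x := by simpa [Nat.even_iff] using hx'
    simpa only [two_mul] using reachable i (by omega)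
  intro i hi
  induction i with
  | zero => exact .refl _
  | succ i ih => exact (ih (by omega)).trans (Adj.reachable (.inr ⟨by simp, .inl rfl⟩))

theorem two_pow_le_ncard_isMinimalSeparator_ladderLineGraph (k : ℕ) :
    2 ^ k ≤ {S | IsMinimalSeparator (ladderLineGraph k) S}.ncard :=
  (Nat.pow_le_pow_right two_pos (le_ncard_setOf_odd k)).trans
    (two_pow_ncard_le_ncard_isMinimalSeparator_doubled (connected_induce_triangleChain k)
      fun m hm => ⟨⟨m - 1, by omega⟩, by grind, .inl (.inl (by grind))⟩)

theorem exists_isClique_inter_isClique_diff_neighborSet_ladderLineGraph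
    (a : Fin (2 * k + 1) × Bool) :
    ∃ X, (ladderLineGraph k).IsClique ((ladderLineGraph k).neighborSet a ∩ X) ∧
      (ladderLineGraph k).IsClique ((ladderLineGraph k).neighborSet a \ X) := by
  refine ⟨{b | b.2 = a.2 ∧ (a.1.1 % 2 = 1 ∨ b.1.1 < a.1.1)}, ?_, ?_⟩
  all_goals
    rintro b ⟨hab, hb⟩ c ⟨hac, hc⟩ hbc
    simp only [mem_neighborSet, ladderLineGraph_adj, Set.mem_ofPred_eq, ne_eq,
      Prod.ext_iff, Fin.ext_iff] at *
    grind

theorem not_isIndContained_ladderLineGraph_of_claw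
    (hH : ∃ a b c d, H.Adj a b ∧ H.Adj a c ∧ H.Adj a d ∧ ¬ H.Adj b c ∧ ¬ H.Adj b d ∧
      ¬ H.Adj c d ∧ b ≠ c ∧ b ≠ d ∧ c ≠ d) : ¬ H ⊴ ladderLineGraph k := by
  rintro ⟨f⟩
  obtain ⟨a, b, c, d, hab, hac, had, hbc, hbd, hcd, hne, hne', hne''⟩ := hH
  rw [← f.map_adj_iff] at hab hac had hbc hbd hcd
  rw [← f.injective.ne_iff] at hne hne' hne''
  obtain ⟨X, hX, hX'⟩ := exists_isClique_inter_isClique_diff_neighborSet_ladderLineGraph (f a)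
  have hX_iff {x y} (hx : (ladderLineGraph k).Adj (f a) x) (hy : (ladderLineGraph k).Adj (f a) y)
      (hxy : ¬ (ladderLineGraph k).Adj x y) (hne : x ≠ y) : x ∈ X ↔ y ∉ X := by
    refine ⟨fun h h' => hxy (hX ⟨hx, h⟩ ⟨hy, h'⟩ hne), fun h => ?_⟩
    by_contra h'
    exact hxy (hX' ⟨hx, h'⟩ ⟨hy, h⟩ hne)
  have hbc_iff := hX_iff hab hac hbc hne
  have hbd_iff := hX_iff hab had hbd hne'
  have hcd_iff := hX_iff hac had hcd hne''
  tauto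

theorem not_isIndContained_ladderLineGraph_of_fourCycle
    (hH : ∃ a b c d, H.Adj a b ∧ H.Adj b c ∧ H.Adj c d ∧ H.Adj d a ∧ ¬ H.Adj a c ∧
      ¬ H.Adj b d ∧ a ≠ c ∧ b ≠ d) : ¬ H ⊴ ladderLineGraph k := by
  rintro ⟨f⟩
  obtain ⟨a, b, c, d, hab, hbc, hcd, hda, hac, hbd, hne, hne'⟩ := hH
  rw [← f.map_adj_iff, ladderLineGraph_adj] at hab hbc hcd hda hac hbd
  rw [← f.injective.ne_iff, ne_eq, Prod.ext_iff, Fin.ext_iff] at hne hne'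
  grind (splits := 20)

theorem not_isIndContained_ladderLineGraph_of_two_triangles
    (hH : ∃ a b c d, H.Adj a c ∧ H.Adj a d ∧ H.Adj b c ∧ H.Adj b d ∧ H.Adj c d ∧ a ≠ b) :
    ¬ H ⊴ ladderLineGraph k := by
  rintro ⟨f⟩
  obtain ⟨a, b, c, d, hac, had, hbc, hbd, hcd, hne⟩ := hH
  rw [← f.map_adj_iff, ladderLineGraph_adj] at hac had hbc hbd hcd
  rw [← f.injective.ne_iff, ne_eq, Prod.ext_iff, Fin.ext_iff] at hne
  grind (splits := 20)

theorem mem_of_isIndContained_ladderLineGraph {X : FinGraph} (hX : X ∈ fourVertexGraphs)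
    (h : X.graph ⊴ ladderLineGraph k) :
    X ∈ ({P4, twoP2, fourP1, P2add2P1, P3addP1, K3addP1, paw} : Set FinGraph) := by
  have not_claw : ¬ claw.graph ⊴ ladderLineGraph k := not_isIndContained_ladderLineGraph_of_claw
    ⟨.inl 0, .inr 0, .inr 1, .inr 2, by simp [claw]⟩
  have not_C4 : ¬ C4.graph ⊴ ladderLineGraph k :=
    not_isIndContained_ladderLineGraph_of_fourCycle (by unfold C4; decide)
  have not_diamond : ¬ diamond.graph ⊴ ladderLineGraph k :=
    not_isIndContained_ladderLineGraph_of_two_triangles (by unfold diamond; decide)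
  have not_K4 : ¬ K4.graph ⊴ ladderLineGraph k :=
    not_isIndContained_ladderLineGraph_of_two_triangles (by unfold K4; decide)
  rcases hX with rfl | rfl | rfl | rfl | rfl | rfl | rfl | rfl | rfl | rfl | rfl <;>
    first | contradiction | simp

end LadderLineGraph

section SmallGraphs

variable {V W ι : Type*}

theorem exists_forall_not_adj_of_isIndContained_sum_bot [Finite V] {F : SimpleGraph V}
    {H : SimpleGraph W} (h : H ⊴ F ⊕g (⊥ : SimpleGraph ι)) (hcard : Nat.card V < Nat.card W) :
    ∃ x, ∀ y, ¬ H.Adj x y := by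
  obtain ⟨f⟩ := h
  by_contra! hH
  have exists_eq_inl (x) : ∃ v, f x = .inl v := by
    obtain ⟨y, hxy⟩ := hH x
    rw [← f.map_adj_iff] at hxy
    cases hx : f x <;> cases hy : f y <;> simp_all
  choose g hg using exists_eq_inl
  have g_injective : g.Injective := fun x y hxy => f.injective (by rw [hg, hg, hxy])
  exact hcard.not_ge (Nat.card_le_card_of_injective g g_injective)

theorem isIndContained_P2add2P1_of_isIndContained_fourP1 [Finite W] {F : SimpleGraph W}
    (h : F ⊴ fourP1.graph) (hcard : Nat.card W ≤ 3) : F ⊴ P2add2P1.graph := by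
  obtain ⟨f⟩ := h
  have not_adj (x y) : ¬ F.Adj x y := by
    rw [← f.map_adj_iff]
    exact id
  have := Fintype.ofFinite W
  obtain ⟨g⟩ : Nonempty (W ↪ Fin 3) :=
    Function.Embedding.nonempty_of_card_le (by simpa [Nat.card_eq_fintype_card] using hcard)
  let independent : Fin 3 ↪ Fin 2 ⊕ Fin 2 := ⟨![.inl 0, .inr 0, .inr 1], by decide⟩
  have not_adj_independent (i j) : ¬ P2add2P1.graph.Adj (independent i) (independent j) := by
    fin_cases i <;> fin_cases j <;> simp [independent, P2add2P1]
  exact ⟨⟨g.trans independent, iff_of_false (not_adj_independent _ _) (not_adj _ _)⟩⟩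

theorem mem_of_forall_not_adj {X : FinGraph} (hX : X ∈ fourVertexGraphs) {x : X.V}
    (hx : ∀ y, ¬ X.graph.Adj x y) : X ∈ ({fourP1, P2add2P1, P3addP1, K3addP1} : Set FinGraph) := by
  have exists_adj_twoP2 : ∀ x, ∃ y, (pathGraph 2 ⊕g pathGraph 2).Adj x y := by
    simp [Sum.forall, Sum.exists, Fin.forall_fin_succ, Fin.exists_fin_succ, pathGraph_adj]
  have exists_adj_claw : ∀ x, ∃ y, (completeBipartiteGraph (Fin 1) (Fin 3)).Adj x y := by
    simp [Sum.forall, Sum.exists]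
  have exists_adj_P4 : ∀ x, ∃ y, (pathGraph 4).Adj x y := by
    simp [Fin.forall_fin_succ, Fin.exists_fin_succ, pathGraph_adj]
  have exists_adj_C4 : ∀ x, ∃ y, (cycleGraph 4).Adj x y := by decide
  have exists_adj_paw : ∀ x, ∃ y, paw.graph.Adj x y := by unfold paw; decide
  have exists_adj_diamond : ∀ x, ∃ y, diamond.graph.Adj x y := by unfold diamond; decide
  have exists_adj_K4 : ∀ x, ∃ y, (⊤ : SimpleGraph (Fin 4)).Adj x y := by decide
  rcases hX with rfl | rfl | rfl | rfl | rfl | rfl | rfl | rfl | rfl | rfl | rfl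
  · simp
  · simp
  · exact absurd (exists_adj_twoP2 x) (not_exists.2 hx)
  · simp
  · exact absurd (exists_adj_claw x) (not_exists.2 hx)
  · exact absurd (exists_adj_P4 x) (not_exists.2 hx)
  · simp
  · exact absurd (exists_adj_C4 x) (not_exists.2 hx)
  · exact absurd (exists_adj_paw x) (not_exists.2 hx)
  · exact absurd (exists_adj_diamond x) (not_exists.2 hx)
  · exact absurd (exists_adj_K4 x) (not_exists.2 hx)

theorem isIndContained_of_card_le_three [Finite W] {F : SimpleGraph W} (hF : Nat.card W ≤ 3) :
    ∃ H ∈ ({P2add2P1, P3addP1, K3addP1} : Set FinGraph), F ⊴ H.graph := by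
  obtain ⟨H, hH, hFH, hHF⟩ := exists_fourVertexGraph_between
    (G := F ⊕g (⊥ : SimpleGraph (Fin 4))) ⟨Embedding.sumInl⟩ (hF.trans (by norm_num))
    (by simp [Nat.card_sum])
  obtain ⟨x, hx⟩ := exists_forall_not_adj_of_isIndContained_sum_bot hHF
    (by rw [card_of_mem_fourVertexGraphs hH]; omega)
  rcases mem_of_forall_not_adj hH hx with rfl | rfl | rfl | rfl
  · exact ⟨P2add2P1, by simp, isIndContained_P2add2P1_of_isIndContained_fourP1 hFH hF⟩
  · exact ⟨P2add2P1, by simp, hFH⟩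
  · exact ⟨P3addP1, by simp, hFH⟩
  · exact ⟨K3addP1, by simp, hFH⟩

end SmallGraphs

section Dichotomy

variable {ℱ ℱ' : Set FinGraph}

/-- `Hits ℱ X`: some member of `ℱ` is an induced subgraph of `X`, that is, `X` is not `ℱ`-free. -/
def Hits (ℱ : Set FinGraph) (X : FinGraph) : Prop :=
  ∃ F ∈ ℱ, F.graph ⊴ X.graph

theorem freeLE_of_forall_hits (h : ∀ X ∈ ℱ', Hits ℱ X) : FreeLE ℱ ℱ' := by
  intro G hG X hX hXG
  obtain ⟨F, hF, hFX⟩ := h X hX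
  exact hG F hF (hFX.trans hXG)

theorem exists_hits_of_tame (hcard : ∀ F ∈ ℱ, Nat.card F.V ≤ 4) (ht : Tame (freeClass ℱ))
    (c d : ℕ) (hcd : 4 ≤ c + d) (G : ℕ → FinGraph) (hG : ∀ k, Nat.card (G k).V = c * k + d)
    (hsep : ∀ k, 2 ^ k ≤ numMinSep (G k)) (𝒳 : Set FinGraph)
    (h𝒳 : ∀ k, ∀ X ∈ fourVertexGraphs, X.graph ⊴ (G k).graph → X ∈ 𝒳) : ∃ X ∈ 𝒳, Hits ℱ X := by
  by_contra! hℱ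
  have mem_freeClass (k) : G (k + 1) ∈ freeClass ℱ := by
    intro F hF hFG
    obtain ⟨H, hH, hFH, hHG⟩ := exists_fourVertexGraph_between hFG (hcard F hF)
      (by rw [hG, mul_add_one]; omega)
    exact hℱ H (h𝒳 _ H hH hHG) ⟨F, hF, hFH⟩
  exact not_tame_of_exponential c (c + d) (fun k => G (k + 1)) mem_freeClass
    (fun k => by rw [hG]; ring)
    (fun k => (Nat.pow_le_pow_right two_pos k.le_succ).trans (hsep (k + 1))) ht

theorem card_fin_prod_bool (n : ℕ) : Nat.card (Fin n × Bool) = 2 * n := by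
  simp [mul_comm]

theorem exists_hits_theta (hcard : ∀ F ∈ ℱ, Nat.card F.V ≤ 4) (ht : Tame (freeClass ℱ)) :
    ∃ X ∈ ({P4, twoP2, fourP1, P2add2P1, P3addP1, claw} : Set FinGraph), Hits ℱ X :=
  exists_hits_of_tame hcard ht 2 2 le_rfl (fun k => ⟨_, theta k⟩)
    (fun k => (card_fin_prod_bool _).trans (by ring)) two_pow_le_ncard_isMinimalSeparator_theta _
    fun _ _ => mem_of_isIndContained_theta

theorem exists_hits_prism (hcard : ∀ F ∈ ℱ, Nat.card F.V ≤ 4) (ht : Tame (freeClass ℱ)) :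
    ∃ X ∈ ({P4, twoP2, K3addP1, paw, C4, K4} : Set FinGraph), Hits ℱ X :=
  exists_hits_of_tame hcard ht 2 2 le_rfl (fun k => ⟨_, prism k⟩)
    (fun k => (card_fin_prod_bool _).trans (by ring)) two_pow_le_ncard_isMinimalSeparator_prism _
    fun _ _ => mem_of_isIndContained_prism

theorem exists_hits_ladderLineGraph (hcard : ∀ F ∈ ℱ, Nat.card F.V ≤ 4)
    (ht : Tame (freeClass ℱ)) :
    ∃ X ∈ ({P4, twoP2, fourP1, P2add2P1, P3addP1, K3addP1, paw} : Set FinGraph), Hits ℱ X :=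
  exists_hits_of_tame hcard ht 4 2 (by norm_num) (fun k => ⟨_, ladderLineGraph k⟩)
    (fun k => (card_fin_prod_bool _).trans (by ring))
    two_pow_le_ncard_isMinimalSeparator_ladderLineGraph _
    fun _ _ => mem_of_isIndContained_ladderLineGraph

theorem exists_isListed_freeLE_of_hits
    (h : Hits ℱ P4 ∨ Hits ℱ twoP2 ∨
      ((∃ F ∈ ({fourP1, P2add2P1, P3addP1, claw} : Set FinGraph), Hits ℱ F) ∧
        (Hits ℱ paw ∨ Hits ℱ K3addP1)) ∨
      ((∃ F ∈ ({fourP1, P2add2P1, P3addP1} : Set FinGraph), Hits ℱ F) ∧ Hits ℱ K4) ∨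
      ((∃ F ∈ ({P2add2P1, P3addP1} : Set FinGraph), Hits ℱ F) ∧ Hits ℱ C4) ∨
      (Hits ℱ fourP1 ∧ Hits ℱ C4 ∧ Hits ℱ diamond)) :
    ∃ ℱ', IsListed ℱ' ∧ FreeLE ℱ ℱ' := by
  suffices ∃ ℱ', IsListed ℱ' ∧ ∀ X ∈ ℱ', Hits ℱ X from
    this.imp fun _ => And.imp_right freeLE_of_forall_hits
  rcases h with h | h | ⟨⟨F, hF, h⟩, h' | h'⟩ | ⟨⟨F, hF, h⟩, h'⟩ | ⟨⟨F, hF, h⟩, h'⟩ | ⟨h, h', h''⟩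
  · exact ⟨{P4}, .inl (.inl rfl), by simpa using h⟩
  · exact ⟨{twoP2}, .inl (.inr rfl), by simpa using h⟩
  · exact ⟨{F, paw}, .inr (.inl ⟨F, hF, rfl⟩), by simp [h, h']⟩
  · exact ⟨{F, K3addP1}, .inr (.inr (.inl ⟨F, hF, rfl⟩)), by simp [h, h']⟩
  · exact ⟨{F, K4}, .inr (.inr (.inr (.inl ⟨F, hF, rfl⟩))), by simp [h, h']⟩
  · exact ⟨{F, C4}, .inr (.inr (.inr (.inr (.inl ⟨F, hF, rfl⟩)))), by simp [h, h']⟩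
  · exact ⟨_, .inr (.inr (.inr (.inr (.inr rfl)))), by simp [h, h', h'']⟩

theorem exists_isListed_freeLE_or_hits (hcard : ∀ F ∈ ℱ, Nat.card F.V ≤ 4)
    (ht : Tame (freeClass ℱ)) :
    (∃ ℱ', IsListed ℱ' ∧ FreeLE ℱ ℱ') ∨ Hits ℱ fourP1 ∧ Hits ℱ C4 ∧
      ∀ X ∈ ({P4, twoP2, P2add2P1, P3addP1, K3addP1, paw, diamond, K4} : Set FinGraph),
        ¬ Hits ℱ X := by
  refine or_iff_not_imp_left.2 fun not_listed => ?_
  have hℱ := mt exists_isListed_freeLE_of_hits not_listed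
  have h_theta := exists_hits_theta hcard ht
  have h_prism := exists_hits_prism hcard ht
  have h_ladder := exists_hits_ladderLineGraph hcard ht
  simp only [Set.mem_insert_iff, Set.mem_singleton_iff, exists_eq_or_imp, exists_eq_left,
    not_or, not_and] at hℱ h_theta h_prism h_ladder
  obtain ⟨not_P4, not_twoP2, not_paw_K3addP1, not_K4, not_C4, not_diamond⟩ := hℱ
  simp only [not_P4, not_twoP2, false_or] at h_theta h_prism h_ladder
  obtain ⟨not_paw, not_K3addP1⟩ := not_paw_K3addP1 h_theta
  simp only [not_paw, not_K3addP1, false_or, or_false] at h_prism h_ladder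
  replace not_K4 := not_K4 h_ladder
  have h_C4 := h_prism.resolve_right not_K4
  obtain ⟨not_P2add2P1, not_P3addP1⟩ := not_or.1 fun h => not_C4 h h_C4
  have h_fourP1 : Hits ℱ fourP1 := by
    simpa only [not_P2add2P1, not_P3addP1, or_false] using h_ladder
  replace not_diamond := not_diamond h_fourP1 h_C4
  refine ⟨h_fourP1, h_C4, ?_⟩
  rintro X (rfl | rfl | rfl | rfl | rfl | rfl | rfl | rfl) <;> assumption

theorem four_le_card_of_not_hits
    (h : ∀ X ∈ ({P2add2P1, P3addP1, K3addP1} : Set FinGraph), ¬ Hits ℱ X) {F : FinGraph}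
    (hF : F ∈ ℱ) : 4 ≤ Nat.card F.V := by
  by_contra! hcard
  obtain ⟨H, hH, hFH⟩ := isIndContained_of_card_le_three (F := F.graph) (Nat.le_of_lt_succ hcard)
  exact h H hH ⟨F, hF, hFH⟩

theorem sameFamily_of_hits (hcard : ∀ F ∈ ℱ, Nat.card F.V ≤ 4) (h_fourP1 : Hits ℱ fourP1)
    (h_C4 : Hits ℱ C4)
    (h : ∀ X ∈ ({P4, twoP2, P2add2P1, P3addP1, K3addP1, paw, diamond, K4} : Set FinGraph),
      ¬ Hits ℱ X) :
    SameFamily ℱ {fourP1, C4} ∨ SameFamily ℱ {fourP1, claw, C4} := by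
  have card_eq (F) (hF : F ∈ ℱ) : Nat.card F.V = 4 :=
    (hcard F hF).antisymm (four_le_card_of_not_hits (fun X hX => h X (by grind)) hF)
  have nonempty_iso : ∀ F ∈ ℱ, ∃ H ∈ ({fourP1, claw, C4} : Set FinGraph),
      Nonempty (F.graph ≃g H.graph) := by
    intro F hF
    obtain ⟨H, hH, hFH, -⟩ := exists_fourVertexGraph_between (.refl F.graph) (hcard F hF)
      (card_eq F hF).ge
    refine ⟨H, ?_, nonempty_iso_of_isIndContained hFH
      ((card_of_mem_fourVertexGraphs hH).trans (card_eq F hF).symm)⟩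
    have not_mem := mt (h H) (not_not.2 ⟨F, hF, hFH⟩)
    simp only [fourVertexGraphs, Set.mem_insert_iff, Set.mem_singleton_iff] at hH not_mem ⊢
    tauto
  have exists_iso_of_hits : ∀ X ∈ fourVertexGraphs, Hits ℱ X →
      ∃ F ∈ ℱ, Nonempty (F.graph ≃g X.graph) := by
    rintro X hX ⟨F, hF, hFX⟩
    exact ⟨F, hF, nonempty_iso_of_isIndContained hFX
      ((card_of_mem_fourVertexGraphs hX).trans (card_eq F hF).symm)⟩
  replace h_fourP1 := exists_iso_of_hits fourP1 (by simp [fourVertexGraphs]) h_fourP1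
  replace h_C4 := exists_iso_of_hits C4 (by simp [fourVertexGraphs]) h_C4
  by_cases h_claw : ∃ F ∈ ℱ, Nonempty (F.graph ≃g claw.graph)
  · exact .inr ⟨nonempty_iso, by rintro H (rfl | rfl | rfl) <;> assumption⟩
  · refine .inl ⟨fun F hF => ?_, by rintro H (rfl | rfl) <;> assumption⟩
    obtain ⟨H, rfl | rfl | rfl, hFH⟩ := nonempty_iso F hF
    · exact ⟨_, by simp, hFH⟩
    · exact absurd ⟨F, hF, hFH⟩ h_claw
    · exact ⟨_, by simp, hFH⟩

theorem exists_isListed_freeLE_of_tame (hcard : ∀ F ∈ ℱ, Nat.card F.V ≤ 4)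
    (h₁ : ¬ SameFamily ℱ {fourP1, C4}) (h₂ : ¬ SameFamily ℱ {fourP1, claw, C4})
    (ht : Tame (freeClass ℱ)) : ∃ ℱ', IsListed ℱ' ∧ FreeLE ℱ ℱ' := by
  refine (exists_isListed_freeLE_or_hits hcard ht).resolve_right ?_
  rintro ⟨h_fourP1, h_C4, hℱ⟩
  exact (sameFamily_of_hits hcard h_fourP1 h_C4 hℱ).elim h₁ h₂

end Dichotomy

end MinSep

theorem theorem1 (ℱ : Set MinSep.FinGraph)
    (hcard : ∀ F ∈ ℱ, Nat.card F.V ≤ 4)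
    (h₁ : ¬ MinSep.SameFamily ℱ {MinSep.fourP1, MinSep.C4})
    (h₂ : ¬ MinSep.SameFamily ℱ {MinSep.fourP1, MinSep.claw, MinSep.C4}) :
    MinSep.Tame (MinSep.freeClass ℱ) ↔
      ∃ ℱ' : Set MinSep.FinGraph, MinSep.IsListed ℱ' ∧ MinSep.FreeLE ℱ ℱ' := by
  refine ⟨MinSep.exists_isListed_freeLE_of_tame hcard h₁ h₂, ?_⟩
  rintro ⟨ℱ', h_listed, h_le⟩
  exact h_listed.tame.mono h_le
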